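/- Let $\mu$ be Lebesgue measure on $\mathbb R$, $\|f\|=\int_{\mathbb R}|f|\,d\mu$, and call $p:\mathbb R\to[0,\infty)$ a density if $p$ is integrable with $\int p\,d\mu=1$. Let $\overline{\mathcal M}^{LC}$ be the set of log-concave densities, i.e. densities $p$ such that $J=\{x: p(x)>0\}$ is an open interval and $\log p$ is continuous and concave on $J$. For $D\ge 1$ let $\overline{\mathcal O}^{LC}_D\subset\overline{\mathcal M}^{LC}$ be the set of those $p$ for which there is a nonempty set $A\subset\mathbb R$ with at most $D$ elements such that, on each of the open intervals that are the connected components of $\mathbb R\setminus A$, $\log p$ is either affine or identically $-\infty$ (i.e. $p=0$ there). For every $D\ge1$ let $\mathcal O^{LC}_D$ be any countable subset of $\overline{\mathcal O}^{LC}_D$ that is dense in it for $\|\cdot\|$, and let $\mathcal M^{LC}$ be any countable subset of $\overline{\mathcal M}^{LC}$ that is dense in it for $\|\cdot\|$ and contains $\bigcup_{D\ge 1}\mathcal O^{LC}_D$. For $p,q\in\mathcal M^{LC}$ and $\mathbf x=(x_1,\dots,x_n)\in\mathbb R^n$ put $$\mathbf T(\mathbf x,p,q)=\sum_{i=1}^n\Big[\mathbf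 1_{\{q>p\}}(x_i)-\int_{\{q>p\}}p\,d\mu\Big],\qquad \mathbf T(\mathbf x,p)=\sup_{q\in\mathcal M^{LC}}\mathbf T(\mathbf x,p,q).$$ Given $\varepsilon>0$, a TV-estimator on $\mathcal M^{LC}$ is any measurable function $\mathbf x\mapsto\widehat p(\mathbf x)\in\mathcal M^{LC}$ of the data (i.e. $\{\mathbf x:\widehat p(\mathbf x)=m\}$ is a Borel set for every $m\in\mathcal M^{LC}$) with $$\mathbf T(\mathbf x,\widehat p(\mathbf x))\le\inf_{p'\in\mathcal M^{LC}}\mathbf T(\mathbf x,p')+\varepsilon\qquad\text{for all }\mathbf x\in\mathbb R^n .$$ **Statement.** Let $n\ge1$, let $X_1,\dots,X_n$ be i.i.d. real random variables with a density $p\in\overline{\mathcal M}^{LC}$, let $\varepsilon>0$, and let $\widehat p=\widehat p(X_1,\dots,X_n)$ be any TV-estimator on $\mathcal M^{LC}$. Then $\|p-\widehat p\|$ is integrable and $$\mathbb E\big[\|p-\widehat p\|\big]\le\frac{300}{n^{2/5}}+\frac{837}{\sqrt n}+\frac{2\varepsilon}{n}.$$ -/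

import Mathlib

open MeasureTheory ProbabilityTheory

noncomputable section

/-- The `L¹`-norm with respect to Lebesgue measure on the line. -/
def l1Norm (f : ℝ → ℝ) : ℝ := ∫ x, |f x|

/-- Probability densities with respect to Lebesgue measure on the line. -/
def IsDensity (p : ℝ → ℝ) : Prop :=
  (∀ x, 0 ≤ p x) ∧ Integrable p ∧ ∫ x, p x = 1

/-- The measure `p · μ`, with `μ` the Lebesgue measure. -/
def densityMeasure (p : ℝ → ℝ) : Measure ℝ :=
  volume.withDensity fun x => ENNReal.ofReal (p x)

/-- The log-concave densities: those `p = exp φ` (with `exp (-∞) = 0`) for which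
`J = {p > 0}` is an open interval and `φ = log p` is continuous and concave on `J`. -/
def logConcaveDensities : Set (ℝ → ℝ) :=
  {p | IsDensity p ∧ IsOpen {x | 0 < p x} ∧ Set.OrdConnected {x | 0 < p x} ∧
    ContinuousOn (fun x => Real.log (p x)) {x | 0 < p x} ∧
    ConcaveOn ℝ {x | 0 < p x} (fun x => Real.log (p x))}

/-- The open intervals into which a finite set `A` of reals cuts the line: the interval around
`x ∉ A` consists of the points that lie strictly on the same side as `x` of each `a ∈ A`. -/
def openPieces (A : Finset ℝ) : Set (Set ℝ) :=
  {I | ∃ x, x ∉ A ∧ I = {y | ∀ a ∈ A, (a < y ↔ a < x) ∧ (y < a ↔ x < a)}}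

/-- The log-concave densities `p` for which there is a nonempty set `A` of at most `D` points such
that, on each of the open intervals determined by `A`, `log p` is either `-∞` or affine. -/
def piecewiseLogAffineDensities (D : ℕ) : Set (ℝ → ℝ) :=
  {p | p ∈ logConcaveDensities ∧ ∃ A : Finset ℝ, A.Nonempty ∧ A.card ≤ D ∧
    ∀ I ∈ openPieces A,
      (∀ x ∈ I, p x = 0) ∨ ∃ a b : ℝ, ∀ x ∈ I, p x = Real.exp (a * x + b)}

/-- `S` is a countable subset of `F` that is dense in `F` for the `L¹`-norm. -/
def IsCountableDenseSubset (S F : Set (ℝ → ℝ)) : Prop :=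
  S.Countable ∧ S ⊆ F ∧ ∀ p ∈ F, ∀ δ > 0, ∃ q ∈ S, l1Norm (p - q) < δ

/-- `M` is a countable and dense subset of the log-concave densities that contains, for every
`D ≥ 1`, a countable and dense subset of the piecewise log-affine ones with parameter `D`. -/
def IsLogConcaveModel (M : Set (ℝ → ℝ)) : Prop :=
  IsCountableDenseSubset M logConcaveDensities ∧
    ∃ O : ℕ → Set (ℝ → ℝ),
      (∀ D, 1 ≤ D → IsCountableDenseSubset (O D) (piecewiseLogAffineDensities D)) ∧
      ∀ D, 1 ≤ D → O D ⊆ M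

/-- The test statistic `t_{(P,Q)} = 1_{q > p} - P(q > p)`. -/
def tvTest (p q : ℝ → ℝ) (x : ℝ) : ℝ :=
  Set.indicator {y | p y < q y} (fun _ => (1 : ℝ)) x - (densityMeasure p).real {y | p y < q y}

/-- `T(x, P, Q) = ∑ᵢ t_{(P,Q)}(xᵢ)`. -/
def tvStatPair {n : ℕ} (x : Fin n → ℝ) (p q : ℝ → ℝ) : ℝ := ∑ i, tvTest p q (x i)

/-- `T(x, P)`, the supremum of `T(x, P, Q)` over `Q` in the model. For densities the summands lie
in `[-1, 1]`, so this is the supremum of a bounded family. -/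
def tvStat {n : ℕ} (M : Set (ℝ → ℝ)) (x : Fin n → ℝ) (p : ℝ → ℝ) : ℝ :=
  ⨆ q : M, tvStatPair x p q

/-- The set of `ε`-minimizers over the model of `P ↦ T(x, P)` (which is nonnegative there, as
`T(x, P, P) = 0`). -/
def tvMinimizers {n : ℕ} (M : Set (ℝ → ℝ)) (ε : ℝ) (x : Fin n → ℝ) : Set (ℝ → ℝ) :=
  {p | p ∈ M ∧ tvStat M x p ≤ (⨅ p' : M, tvStat M x p') + ε}

/-- A TV-estimator on the countable model `M`: a function of the data with values in `M`,
measurable for the discrete `σ`-algebra on `M`, which selects an `ε`-minimizer. -/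
structure IsTVEstimator {n : ℕ} (M : Set (ℝ → ℝ)) (ε : ℝ)
    (phat : (Fin n → ℝ) → (ℝ → ℝ)) : Prop where
  measurable : ∀ m ∈ M, MeasurableSet {x | phat x = m}
  mem_minimizers : ∀ x, phat x ∈ tvMinimizers M ε x

end

/-!
The loss of a TV-estimator is compared with a piecewise log-affine density `r` of the model.

*Stochastic error.* Write `p` for the true density, `q` for the estimator, and `P`, `Q`, `R` for
the probability measures with densities `p`, `q`, `r`. Since `Q(q > r) - R(q > r)` is half of the
`L¹`-distance of `q` and `r`, and since passing from `R` to `P` changes probabilities by at most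
half of the `L¹`-distance of `p` and `r`, the almost minimality of `q` gives a deterministic
inequality `‖p - q‖ ≤ 3 ‖p - r‖ + (2 / n) (Z + Z' + ε)`, where `Z` and `Z'` are suprema of the
centred empirical process over the sets `{q > r}` and `{q ≥ r}`, `q` in the model
(`l1Norm_sub_le_of_mem_tvMinimizers`). On each of the `D + 1` pieces on which `log r` is affine or
`-∞`, these sets are intervals, because `log q` is concave there. After symmetrization the
supremum over the intervals in a piece is at most the sum of the maximal partial sums of random
signs and of their negatives, which an `L²` maximal inequality bounds by a multiple of the square
root of the number of sample points in the piece; by Cauchy–Schwarz over the pieces,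
`E Z ≤ 8 √((D + 1) n)` with no logarithmic factor (`integral_iSup_empirical_le`,
`risk_le_of_piecewiseLogAffine`).

*Approximation error.* A log-concave density is approximated within `O(K⁻²)`, with a universal
constant, by a piecewise log-affine one with at most `2 K` break points
(`exists_piecewiseLogAffine_approx`). With `c = sup p`, each tail is described by the right end
point `β y` of the superlevel set `{p > c exp (-y)}`, a concave function of `y`. The tail is
interpolated by chords of `log p` at the points `β (y i)` for the fixed levels `gradedLevel K i`.
A chord lies below `log p` over its own interval and above it elsewhere, so that the interpolant
is the minimum of the chords, hence concave; and the error of a chord is controlled by the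
decrease of the secant slopes of `β` (`IsTailProfile.sub_chordLine_le`). Summation by parts and
the bound of the secant slopes by the inverse level give the rate
(`IsTailProfile.integral_abs_sub_graded_le`).

The choice `K ≈ 20 n ^ (1/5)` balances the two errors (`exists_oracle_bound`). Distances between
densities are at most `2`, so that only large `n` have to be considered.
-/

/-! ### Maximal inequality for Rademacher partial sums -/

/-- The sign `±1` encoded by a Boolean. -/
def boolSign (b : Bool) : ℝ := if b then 1 else -1

lemma boolSign_not (b : Bool) : boolSign (!b) = -boolSign b := by
  cases b <;> simp [boolSign]

lemma boolSign_sq (b : Bool) : boolSign b ^ 2 = 1 := by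
  cases b <;> simp [boolSign]

lemma sum_mul_boolSign_eq_zero {ι : Type*} [Fintype ι] [DecidableEq ι] (i : ι)
    (F : (ι → Bool) → ℝ) (hF : ∀ σ, F (Function.update σ i (!σ i)) = F σ) :
    ∑ σ, F σ * boolSign (σ i) = 0 := by
  refine Finset.sum_involution (fun σ _ => Function.update σ i (!σ i)) ?_ ?_ ?_ ?_
  · intro σ _
    simp [hF, boolSign_not]
  · intro σ _ _ h
    have := congrFun h i
    simp at this
  · intros; simp
  · intro σ _
    simp

/-- The partial sums of signs, taken in the order of the points `x i`, have a maximal function `M`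
that satisfies `M ^ 2 ≤ 2 M S - 2 H`, with `S` the full sum and `H` a discrete stochastic integral,
of mean zero. By induction over the points in increasing order: the new maximum is `max M S'`, with
`S'` the new full sum, and `H` grows by `M` times the new sign. -/
lemma exists_maximal_function {ι : Type*} [Fintype ι] [DecidableEq ι] (x : ι → ℝ)
    (s : Finset ι) :
    ∃ M H : (ι → Bool) → ℝ,
      (∀ i ∉ s, ∀ σ, M (Function.update σ i (!σ i)) = M σ) ∧ (∀ σ, 0 ≤ M σ) ∧
      (∀ σ, ∀ L : Set ℝ, IsLowerSet L →
        ∑ i ∈ s, L.indicator (fun _ => boolSign (σ i)) (x i) ≤ M σ) ∧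
      ∑ σ, H σ = 0 ∧
      (∀ σ, M σ ^ 2 ≤ 2 * M σ * (∑ i ∈ s, boolSign (σ i)) - 2 * H σ) ∧
      ∑ σ : ι → Bool, (∑ i ∈ s, boolSign (σ i)) ^ 2 = (s.card : ℝ) * 2 ^ Fintype.card ι := by
  induction s using Finset.induction_on_max_value x with
  | empty => exact ⟨0, 0, by simp, by simp, by simp, by simp, by simp, by simp⟩
  | insert i s his hmax ih =>
    obtain ⟨M, H, hM, h0, hL, hH, hMH, hS⟩ := ih
    have hSflip : ∀ j ∉ s, ∀ σ : ι → Bool,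
        ∑ k ∈ s, boolSign (Function.update σ j (!σ j) k) = ∑ k ∈ s, boolSign (σ k) := by
      intro j hj σ
      refine Finset.sum_congr rfl fun k hk => ?_
      rw [Function.update_of_ne]
      rintro rfl; exact hj hk
    refine ⟨fun σ => max (M σ) (∑ k ∈ insert i s, boolSign (σ k)),
      fun σ => H σ + M σ * boolSign (σ i), ?_, ?_, ?_, ?_, ?_, ?_⟩
    · intro j hj σ
      have hj' : j ∉ s := fun h => hj (Finset.mem_insert_of_mem h)
      have hji : i ≠ j := fun h => hj (h ▸ Finset.mem_insert_self i s)
      simp only [Finset.sum_insert his, hM j hj', hSflip j hj', Function.update_of_ne hji]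
    · intro σ
      exact le_max_of_le_left (h0 σ)
    · intro σ L hLow
      by_cases hi : x i ∈ L
      · refine le_max_of_le_right (le_of_eq (Finset.sum_congr rfl fun k hk => ?_))
        rw [Set.indicator_of_mem]
        rcases Finset.mem_insert.1 hk with rfl | hk
        · exact hi
        · exact hLow (hmax k hk) hi
      · rw [Finset.sum_insert his, Set.indicator_of_notMem hi, zero_add]
        exact le_max_of_le_left (hL σ L hLow)
    · rw [Finset.sum_add_distrib, hH, sum_mul_boolSign_eq_zero i M (hM i his), add_zero]
    · intro σ
      have h1 := hMH σ
      simp only [Finset.sum_insert his]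
      set S := ∑ k ∈ s, boolSign (σ k)
      set d := boolSign (σ i)
      rcases le_total (M σ) (d + S) with h | h
      · rw [max_eq_right h]
        nlinarith [sq_nonneg (d + S - M σ)]
      · rw [max_eq_left h]
        nlinarith
    · have : ∀ σ : ι → Bool, (∑ k ∈ insert i s, boolSign (σ k)) ^ 2 =
          1 + 2 * ((∑ k ∈ s, boolSign (σ k)) * boolSign (σ i))
            + (∑ k ∈ s, boolSign (σ k)) ^ 2 := by
        intro σ
        rw [Finset.sum_insert his, ← boolSign_sq (σ i)]
        ring
      simp only [this]
      rw [Finset.sum_add_distrib, Finset.sum_add_distrib, ← Finset.mul_sum, hS,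
        sum_mul_boolSign_eq_zero i (fun σ => ∑ k ∈ s, boolSign (σ k)) (hSflip i his),
        Finset.card_insert_of_notMem his]
      simp
      ring

/-- The Rademacher complexity of the class of intervals on a sample of `N` points is at most
`4 √N`. -/
lemma exists_interval_bound {ι : Type*} [Fintype ι] [DecidableEq ι] (x : ι → ℝ) (s : Finset ι) :
    ∃ R : (ι → Bool) → ℝ,
      ∑ σ, R σ ≤ 2 ^ Fintype.card ι * (4 * √(s.card : ℝ)) ∧
      ∀ σ, ∀ J : Set ℝ, J.OrdConnected →
        ∑ i ∈ s, J.indicator (fun _ => boolSign (σ i)) (x i) ≤ R σ := by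
  obtain ⟨M, H, hM, h0, hL, hH, hMH, hS⟩ := exists_maximal_function x s
  have hsq : ∑ σ, M σ ^ 2 ≤ 4 * ((s.card : ℝ) * 2 ^ Fintype.card ι) := by
    have h : ∀ σ, M σ ^ 2 ≤ 4 * (∑ i ∈ s, boolSign (σ i)) ^ 2 - 4 * H σ := by
      intro σ
      nlinarith [hMH σ, sq_nonneg (M σ - 2 * ∑ i ∈ s, boolSign (σ i))]
    calc ∑ σ, M σ ^ 2 ≤ ∑ σ, (4 * (∑ i ∈ s, boolSign (σ i)) ^ 2 - 4 * H σ) :=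
          Finset.sum_le_sum fun σ _ => h σ
      _ = _ := by
          rw [Finset.sum_sub_distrib, ← Finset.mul_sum, ← Finset.mul_sum, hS, hH]; ring
  have hsum : ∑ σ, M σ ≤ 2 ^ Fintype.card ι * (2 * √(s.card : ℝ)) := by
    have hcs := sq_sum_le_card_mul_sum_sq (s := (Finset.univ : Finset (ι → Bool))) (f := M)
    have hc : ((Finset.univ : Finset (ι → Bool)).card : ℝ) = 2 ^ Fintype.card ι := by simp
    rw [hc] at hcs
    refine le_of_sq_le_sq ?_ (by positivity)
    have h2 : (2 : ℝ) ^ Fintype.card ι * ∑ σ, M σ ^ 2 ≤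
        2 ^ Fintype.card ι * (4 * ((s.card : ℝ) * 2 ^ Fintype.card ι)) := by gcongr
    have h3 := Real.sq_sqrt (Nat.cast_nonneg (α := ℝ) s.card)
    calc _ ≤ _ := hcs.trans h2
      _ = (2 ^ Fintype.card ι) ^ 2 * (4 * √(s.card : ℝ) ^ 2) := by rw [h3]; ring
      _ = _ := by ring
  have hflip : ∑ σ : ι → Bool, M (fun i => !σ i) = ∑ σ, M σ := by
    refine Fintype.sum_equiv ⟨fun σ i => !σ i, fun σ i => !σ i, ?_, ?_⟩ _ _ fun _ => rfl <;>
    · intro σ; simp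
  refine ⟨fun σ => M σ + M fun i => !σ i, ?_, ?_⟩
  · rw [Finset.sum_add_distrib, hflip]
    linarith
  · intro σ J hJ
    -- an interval is the difference of two initial segments
    have h1 : IsLowerSet (lowerClosure J : Set ℝ) := (lowerClosure J).lower
    have h2 : IsLowerSet ((lowerClosure J : Set ℝ) \ J) := by
      intro a b hba ha
      refine ⟨h1 hba ha.1, fun hb => ha.2 ?_⟩
      obtain ⟨c, hc, hac⟩ := mem_lowerClosure.1 ha.1
      exact hJ.out hb hc ⟨hba, hac⟩
    have e1 := hL σ _ h1
    have e2 := hL (fun i => !σ i) _ h2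
    refine le_trans (le_of_eq ?_) (add_le_add e1 e2)
    rw [← Finset.sum_add_distrib]
    refine Finset.sum_congr rfl fun i _ => ?_
    by_cases hi : x i ∈ J
    · have : x i ∈ (lowerClosure J : Set ℝ) := subset_lowerClosure hi
      rw [Set.indicator_of_mem hi, Set.indicator_of_mem this,
        Set.indicator_of_notMem (by simp [hi]), add_zero]
    · by_cases hi' : x i ∈ (lowerClosure J : Set ℝ)
      · rw [Set.indicator_of_notMem hi, Set.indicator_of_mem hi', 
          Set.indicator_of_mem (show x i ∈ (lowerClosure J : Set ℝ) \ J from ⟨hi', hi⟩),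
          boolSign_not]
        ring
      · rw [Set.indicator_of_notMem hi, Set.indicator_of_notMem hi',
          Set.indicator_of_notMem (fun h => hi' h.1), add_zero]

/-- Sets that meet each of `N` given pieces of the line in an interval: their Rademacher complexity
on `n` points is at most `4 √(N n)`, by Cauchy–Schwarz over the pieces. -/
lemma exists_piecewise_interval_bound {ι : Type*} [Fintype ι] [DecidableEq ι] {N : ℕ}
    (κ : ℝ → Fin N) (x : ι → ℝ) :
    ∃ R : (ι → Bool) → ℝ,
      ∑ σ, R σ ≤ 2 ^ Fintype.card ι * (4 * √((N : ℝ) * Fintype.card ι)) ∧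
      ∀ σ, ∀ C : Set ℝ, (∀ j, (C ∩ κ ⁻¹' {j}).OrdConnected) →
        ∑ i, C.indicator (fun _ => boolSign (σ i)) (x i) ≤ R σ := by
  choose R hR hC using fun j : Fin N =>
    exists_interval_bound x (Finset.univ.filter fun i => κ (x i) = j)
  refine ⟨fun σ => ∑ j, R j σ, ?_, ?_⟩
  · rw [Finset.sum_comm]
    refine (Finset.sum_le_sum fun j _ => hR j).trans ?_
    rw [← Finset.mul_sum, ← Finset.mul_sum]
    gcongr
    refine Real.le_sqrt_of_sq_le ?_
    have hcard := Finset.card_eq_sum_card_fiberwise (s := (Finset.univ : Finset ι))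
      (t := (Finset.univ : Finset (Fin N))) (f := fun i => κ (x i)) fun _ _ => by simp
    refine (sq_sum_le_card_mul_sum_sq (s := Finset.univ)).trans (le_of_eq ?_)
    simp only [Real.sq_sqrt (Nat.cast_nonneg _)]
    rw [Finset.card_univ, Fintype.card_fin, ← Nat.cast_sum, ← hcard, Finset.card_univ]
  · intro σ C hCo
    rw [← Finset.sum_fiberwise Finset.univ (fun i => κ (x i))]
    refine Finset.sum_le_sum fun j _ => ?_
    refine le_trans (le_of_eq (Finset.sum_congr rfl fun i hi => ?_)) (hC j σ _ (hCo j))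
    have : κ (x i) = j := (Finset.mem_filter.1 hi).2
    by_cases h : x i ∈ C
    · rw [Set.indicator_of_mem h, 
        Set.indicator_of_mem (show x i ∈ C ∩ κ ⁻¹' {j} from ⟨h, this⟩)]
    · rw [Set.indicator_of_notMem h, Set.indicator_of_notMem fun h' => h h'.1]

/-! ### Symmetrization -/

/-- The centred empirical process over a countable class of sets that meet each of `N` pieces of
the line in an interval. Symmetrization by an independent copy of the sample reduces its expected
supremum to the Rademacher complexity of the class. -/
lemma integral_iSup_empirical_le {n N : ℕ} (μ : Measure ℝ) [IsProbabilityMeasure μ]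
    {Q : Type*} [Countable Q] [Nonempty Q] (C : Q → Set ℝ) (hC : ∀ q, MeasurableSet (C q))
    (κ : ℝ → Fin N) (hκ : ∀ q j, (C q ∩ κ ⁻¹' {j}).OrdConnected) :
    Integrable (fun x : Fin n → ℝ =>
        ⨆ q, ∑ i, ((C q).indicator (fun _ => (1 : ℝ)) (x i) - μ.real (C q)))
        (Measure.pi fun _ => μ) ∧
      ∫ x : Fin n → ℝ, ⨆ q, ∑ i, ((C q).indicator (fun _ => (1 : ℝ)) (x i) - μ.real (C q))
        ∂(Measure.pi fun _ => μ) ≤ 8 * √((N : ℝ) * n) := by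
  set ν : Measure (Fin n → ℝ) := Measure.pi fun _ => μ
  set g : Q → ℝ → ℝ := fun q => (C q).indicator fun _ => (1 : ℝ) with hg
  have hg0 : ∀ q y, 0 ≤ g q y := fun q y => Set.indicator_nonneg (fun _ _ => zero_le_one) y
  have hg1 : ∀ q y, g q y ≤ 1 := fun q y =>
    Set.indicator_le_self' (f := fun _ => (1 : ℝ)) (fun _ _ => zero_le_one) y
  have hgm : ∀ q, Measurable (g q) := fun q => measurable_const.indicator (hC q)
  have hμ0 : ∀ q, 0 ≤ μ.real (C q) := fun q => measureReal_nonneg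
  have hμ1 : ∀ q, μ.real (C q) ≤ 1 := fun q => measureReal_le_one
  have hint : ∀ q, ∫ y, g q y ∂μ = μ.real (C q) := fun q => by
    simp [hg, integral_indicator (hC q)]
  -- bounds on sums of `n` terms of absolute value at most one
  have hsum : ∀ a : Fin n → ℝ, (∀ i, |a i| ≤ 1) → |∑ i, a i| ≤ n := by
    intro a ha
    refine (Finset.abs_sum_le_sum_abs _ _).trans ?_
    simpa using Finset.sum_le_sum fun i (_ : i ∈ Finset.univ) => ha i
  have hsup : ∀ f : Q → ℝ, (∀ q, |f q| ≤ n) → BddAbove (Set.range f) ∧ |⨆ q, f q| ≤ n := by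
    intro f hf
    have hb : BddAbove (Set.range f) := ⟨n, by rintro _ ⟨q, rfl⟩; exact (abs_le.1 (hf q)).2⟩
    refine ⟨hb, abs_le.2 ⟨?_, ciSup_le fun q => (abs_le.1 (hf q)).2⟩⟩
    exact (abs_le.1 (hf (Classical.arbitrary Q))).1.trans (le_ciSup hb _)
  have hZb : ∀ (x : Fin n → ℝ) q, |∑ i, (g q (x i) - μ.real (C q))| ≤ n := fun x q =>
    hsum _ fun i => abs_le.2 ⟨by linarith [hg0 q (x i), hμ1 q], by linarith [hg1 q (x i), hμ0 q]⟩
  set G : (Fin n → ℝ) × (Fin n → ℝ) → ℝ := fun w => ⨆ q, ∑ i, (g q (w.1 i) - g q (w.2 i)) with hG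
  have hGb : ∀ (w : (Fin n → ℝ) × (Fin n → ℝ)) q, |∑ i, (g q (w.1 i) - g q (w.2 i))| ≤ n :=
    fun w q => hsum _ fun i => abs_le.2
      ⟨by linarith [hg0 q (w.1 i), hg1 q (w.2 i)], by linarith [hg1 q (w.1 i), hg0 q (w.2 i)]⟩
  have hZint : Integrable (fun x : Fin n → ℝ => ⨆ q, ∑ i, (g q (x i) - μ.real (C q))) ν := by
    refine Integrable.of_bound (C := n) ?_ (Filter.Eventually.of_forall fun x => (hsup _ (hZb x)).2)
    refine (Measurable.iSup fun q => ?_).aestronglyMeasurable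
    exact Finset.measurable_sum _ fun i _ =>
      ((hgm q).comp (measurable_pi_apply i)).sub measurable_const
  refine ⟨hZint, ?_⟩
  have hGm : Measurable G := Measurable.iSup fun q => Finset.measurable_sum _ fun i _ =>
      ((hgm q).comp ((measurable_pi_apply i).comp measurable_fst)).sub
        ((hgm q).comp ((measurable_pi_apply i).comp measurable_snd))
  have hGint : Integrable G (ν.prod ν) :=
    Integrable.of_bound (C := n) hGm.aestronglyMeasurable
      (Filter.Eventually.of_forall fun w => (hsup _ (hGb w)).2)
  -- the independent copy
  have hcopy : ∫ x, ⨆ q, ∑ i, (g q (x i) - μ.real (C q)) ∂ν ≤ ∫ w, G w ∂(ν.prod ν) := by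
    rw [integral_prod _ hGint]
    refine integral_mono hZint hGint.integral_prod_left fun x => ciSup_le fun q => ?_
    have hgi : ∀ i, Integrable (fun x' : Fin n → ℝ => g q (x' i)) ν := fun i =>
      Integrable.of_bound (C := 1) ((hgm q).comp (measurable_pi_apply i)).aestronglyMeasurable
        (Filter.Eventually.of_forall fun x' => abs_le.2 ⟨by linarith [hg0 q (x' i)], hg1 q _⟩)
    have hgi' : ∀ i, ∫ x' : Fin n → ℝ, g q (x' i) ∂ν = μ.real (C q) := fun i => by
      rw [← hint q]
      have := measurePreserving_eval (fun _ : Fin n => μ) i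
      rw [← this.map_eq, integral_map this.measurable.aemeasurable
        (hgm q).aestronglyMeasurable]
    have e : ∑ i, (g q (x i) - μ.real (C q)) =
        ∫ x' : Fin n → ℝ, ∑ i, (g q (x i) - g q (x' i)) ∂ν := by
      rw [integral_finsetSum (f := fun i (x' : Fin n → ℝ) => g q (x i) - g q (x' i)) _
        fun i _ => (integrable_const _).sub (hgi i)]
      refine Finset.sum_congr rfl fun i _ => ?_
      rw [integral_sub (integrable_const _) (hgi i), hgi' i]
      simp
    rw [e]
    exact integral_mono (integrable_finsetSum _ fun i _ => (integrable_const _).sub (hgi i))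
      (Integrable.of_bound (C := n) (hGm.comp measurable_prodMk_left).aestronglyMeasurable
        (Filter.Eventually.of_forall fun x' => (hsup _ (hGb (x, x'))).2))
      fun x' => le_ciSup (hsup _ (hGb (x, x'))).1 q
  -- exchanging coordinates of the two samples
  have hswap : ∀ σ : Fin n → Bool, ∫ w, G w ∂(ν.prod ν) =
      ∫ w, (⨆ q, ∑ i, boolSign (σ i) * (g q (w.1 i) - g q (w.2 i))) ∂(ν.prod ν) := by
    intro σ
    have hE := measurePreserving_arrowProdEquivProdArrow ℝ ℝ (Fin n) (fun _ => μ) (fun _ => μ)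
    rw [← hE.integral_comp', ← hE.integral_comp']
    have hT : MeasurePreserving
        (fun (w : Fin n → ℝ × ℝ) i => (if σ i then id else Prod.swap) (w i))
        (Measure.pi fun _ => μ.prod μ) (Measure.pi fun _ => μ.prod μ) := by
      refine measurePreserving_pi (f := fun i => if σ i then id else Prod.swap) _ _ fun i => ?_
      split_ifs
      · exact MeasurePreserving.id _
      · exact Measure.measurePreserving_swap
    conv_lhs => rw [← hT.map_eq]
    rw [integral_map hT.measurable.aemeasurable
      (f := fun w => G (MeasurableEquiv.arrowProdEquivProdArrow ℝ ℝ (Fin n) w))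
      (hGm.comp hE.measurable).aestronglyMeasurable]
    refine integral_congr_ae (Filter.Eventually.of_forall fun w => ?_)
    refine iSup_congr fun q => Finset.sum_congr rfl fun i _ => ?_
    simp only [MeasurableEquiv.arrowProdEquivProdArrow, Equiv.arrowProdEquivProdArrow,
      MeasurableEquiv.coe_mk, Equiv.coe_fn_mk]
    cases h : σ i <;> simp [boolSign]
  have havg : ∀ w : (Fin n → ℝ) × (Fin n → ℝ),
      ∑ σ : Fin n → Bool, (⨆ q, ∑ i, boolSign (σ i) * (g q (w.1 i) - g q (w.2 i))) ≤
        2 ^ n * (8 * √((N : ℝ) * n)) := by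
    intro w
    obtain ⟨R, hR, hRC⟩ := exists_piecewise_interval_bound κ w.1
    obtain ⟨R', hR', hRC'⟩ := exists_piecewise_interval_bound κ w.2
    have hflip : ∑ σ : Fin n → Bool, R' (fun i => !σ i) = ∑ σ, R' σ := by
      refine Fintype.sum_equiv ⟨fun σ i => !σ i, fun σ i => !σ i, ?_, ?_⟩ _ _ fun _ => rfl <;>
      · intro σ; simp
    have : ∀ σ : Fin n → Bool, (⨆ q, ∑ i, boolSign (σ i) * (g q (w.1 i) - g q (w.2 i))) ≤
        R σ + R' fun i => !σ i := by
      intro σ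
      refine ciSup_le fun q => ?_
      refine le_trans (le_of_eq ?_) (add_le_add (hRC σ (C q) (hκ q)) (hRC' _ (C q) (hκ q)))
      rw [← Finset.sum_add_distrib]
      refine Finset.sum_congr rfl fun i _ => ?_
      by_cases h1 : w.1 i ∈ C q <;> by_cases h2 : w.2 i ∈ C q <;>
        simp [hg, h1, h2, boolSign_not]
    refine (Finset.sum_le_sum fun σ _ => this σ).trans ?_
    rw [Finset.sum_add_distrib, hflip]
    simp only [Fintype.card_fin] at hR hR'
    linarith
  have hSint : ∀ σ : Fin n → Bool, Integrable
      (fun w : (Fin n → ℝ) × (Fin n → ℝ) =>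
        ⨆ q, ∑ i, boolSign (σ i) * (g q (w.1 i) - g q (w.2 i))) (ν.prod ν) := by
    intro σ
    refine Integrable.of_bound (C := n) ?_
      (Filter.Eventually.of_forall fun w => (hsup _ fun q => hsum _ fun i => ?_).2)
    · exact (Measurable.iSup fun q => Finset.measurable_sum _ fun i _ => measurable_const.mul
        (((hgm q).comp ((measurable_pi_apply i).comp measurable_fst)).sub
        ((hgm q).comp ((measurable_pi_apply i).comp measurable_snd)))).aestronglyMeasurable
    · have : |boolSign (σ i)| = 1 := by cases σ i <;> simp [boolSign]
      rw [abs_mul, this, one_mul]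
      exact abs_le.2 ⟨by linarith [hg0 q (w.1 i), hg1 q (w.2 i)],
        by linarith [hg1 q (w.1 i), hg0 q (w.2 i)]⟩
  have hfin : (2 : ℝ) ^ n * ∫ w, G w ∂(ν.prod ν) ≤ 2 ^ n * (8 * √((N : ℝ) * n)) := by
    have : (2 : ℝ) ^ n * ∫ w, G w ∂(ν.prod ν) = ∑ _σ : Fin n → Bool, ∫ w, G w ∂(ν.prod ν) := by
      simp
    rw [this, Finset.sum_congr rfl fun σ _ => hswap σ, ← integral_finsetSum _ fun σ _ => hSint σ]
    refine (integral_mono (integrable_finsetSum _ fun σ _ => hSint σ) (integrable_const _)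
      havg).trans ?_
    simp
  exact hcopy.trans (le_of_mul_le_mul_left hfin (by positivity))

/-! ### Densities and total variation -/

lemma measurable_of_mem_logConcaveDensities {p : ℝ → ℝ} (hp : p ∈ logConcaveDensities) :
    Measurable p := by
  obtain ⟨⟨h0, -, -⟩, hJ, -, hc, -⟩ := hp
  have h1 : Measurable (Set.indicator {x | 0 < p x} (fun x => Real.exp (Real.log (p x)))) := by
    have hc' := Real.continuous_exp.comp_continuousOn hc
    classical
    exact hc'.measurable_piecewise (g := fun _ => 0) continuousOn_const hJ.measurableSet
  convert h1 using 1
  ext x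
  by_cases hx : 0 < p x
  · rw [Set.indicator_of_mem (show x ∈ {x | 0 < p x} from hx), Real.exp_log hx]
  · rw [Set.indicator_of_notMem (show x ∉ {x | 0 < p x} from hx)]
    exact le_antisymm (not_lt.1 hx) (h0 x)

lemma densityMeasure_real {p : ℝ → ℝ} (hp : IsDensity p) {S : Set ℝ} (hS : MeasurableSet S) :
    (densityMeasure p).real S = ∫ x in S, p x := by
  rw [measureReal_def, densityMeasure, withDensity_apply _ hS,
    ← ofReal_integral_eq_lintegral_ofReal hp.2.1.integrableOn
      (Filter.Eventually.of_forall fun x => hp.1 x),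
    ENNReal.toReal_ofReal (integral_nonneg fun x => hp.1 x)]

lemma isProbabilityMeasure_densityMeasure {p : ℝ → ℝ} (hp : IsDensity p) :
    IsProbabilityMeasure (densityMeasure p) := by
  constructor
  rw [densityMeasure, withDensity_apply _ MeasurableSet.univ, Measure.restrict_univ,
    ← ofReal_integral_eq_lintegral_ofReal hp.2.1 (Filter.Eventually.of_forall fun x => hp.1 x),
    hp.2.2, ENNReal.ofReal_one]

lemma densityMeasure_finset (p : ℝ → ℝ) (A : Finset ℝ) : densityMeasure p A = 0 :=
  withDensity_absolutelyContinuous _ _ (A.finite_toSet.measure_zero volume)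

lemma l1Norm_sub_comm (p q : ℝ → ℝ) : l1Norm (p - q) = l1Norm (q - p) := by
  simp only [l1Norm, Pi.sub_apply, abs_sub_comm]

lemma l1Norm_nonneg (p : ℝ → ℝ) : 0 ≤ l1Norm p := integral_nonneg fun _ => abs_nonneg _

lemma l1Norm_sub_le {p q r : ℝ → ℝ} (hp : Integrable p) (hq : Integrable q) (hr : Integrable r) :
    l1Norm (p - r) ≤ l1Norm (p - q) + l1Norm (q - r) := by
  rw [l1Norm, l1Norm, l1Norm, ← integral_add (hp.sub hq).abs (hq.sub hr).abs]
  refine integral_mono (hp.sub hr).abs ((hp.sub hq).abs.add (hq.sub hr).abs) fun x => ?_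
  exact abs_sub_le _ _ _

lemma l1Norm_sub_le_two {p q : ℝ → ℝ} (hp : IsDensity p) (hq : IsDensity q) :
    l1Norm (p - q) ≤ 2 := by
  have h : l1Norm (p - q) ≤ ∫ x, (p x + q x) :=
    integral_mono (hp.2.1.sub hq.2.1).abs (hp.2.1.add hq.2.1) fun x => by
      refine (abs_sub _ _).trans ?_
      simp [abs_of_nonneg (hp.1 x), abs_of_nonneg (hq.1 x)]
  rw [integral_add hp.2.1 hq.2.1, hp.2.2, hq.2.2] at h
  linarith

lemma setIntegral_sub_setIntegral_eq {p q : ℝ → ℝ} (hp : IsDensity p) (hq : IsDensity q) {S : Set ℝ}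
    (hS : MeasurableSet S) :
    (∫ x in S, p x) - ∫ x in S, q x = ((∫ x in S, (p x - q x)) + ∫ x in Sᶜ, (q x - p x)) / 2 := by
  have h1 := integral_add_compl hS hp.2.1
  have h2 := integral_add_compl hS hq.2.1
  rw [hp.2.2] at h1
  rw [hq.2.2] at h2
  rw [integral_sub hp.2.1.integrableOn hq.2.1.integrableOn,
    integral_sub hq.2.1.integrableOn hp.2.1.integrableOn]
  linarith

lemma densityMeasure_real_sub_le {p q : ℝ → ℝ} (hp : IsDensity p) (hq : IsDensity q) {S : Set ℝ}
    (hS : MeasurableSet S) :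
    (densityMeasure p).real S - (densityMeasure q).real S ≤ l1Norm (p - q) / 2 := by
  rw [densityMeasure_real hp hS, densityMeasure_real hq hS, setIntegral_sub_setIntegral_eq hp hq hS]
  have hi : Integrable fun x => |(p - q) x| := (hp.2.1.sub hq.2.1).abs
  have h := integral_add_compl hS hi
  have h1 : ∫ x in S, (p x - q x) ≤ ∫ x in S, |(p - q) x| :=
    integral_mono (hp.2.1.sub hq.2.1).integrableOn hi.integrableOn fun x => le_abs_self _
  have h2 : ∫ x in Sᶜ, (q x - p x) ≤ ∫ x in Sᶜ, |(p - q) x| :=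
    integral_mono (hq.2.1.sub hp.2.1).integrableOn hi.integrableOn fun x => by
      simpa using neg_le_abs (p x - q x)
  rw [l1Norm]
  linarith

lemma densityMeasure_real_sub_eq {p q : ℝ → ℝ} (hp : IsDensity p) (hq : IsDensity q)
    (hS : MeasurableSet {x | q x < p x}) :
    (densityMeasure p).real {x | q x < p x} - (densityMeasure q).real {x | q x < p x} =
      l1Norm (p - q) / 2 := by
  rw [densityMeasure_real hp hS, densityMeasure_real hq hS, setIntegral_sub_setIntegral_eq hp hq hS]
  have hi : Integrable fun x => |(p - q) x| := (hp.2.1.sub hq.2.1).abs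
  have h := integral_add_compl hS hi
  have h1 : ∫ x in {x | q x < p x}, (p x - q x) = ∫ x in {x | q x < p x}, |(p - q) x| :=
    setIntegral_congr_fun hS fun x hx => (abs_of_pos (sub_pos.2 hx)).symm
  have h2 : ∫ x in {x | q x < p x}ᶜ, (q x - p x) = ∫ x in {x | q x < p x}ᶜ, |(p - q) x| :=
    setIntegral_congr_fun hS.compl fun x hx => by
      have : p x ≤ q x := not_lt.1 hx
      simp only [Pi.sub_apply]
      rw [abs_of_nonpos (sub_nonpos.2 this), neg_sub]
  rw [h1, h2, h, l1Norm]

/-! ### Comparison of a log-concave density with a piecewise log-affine one -/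

/-- Where a comparison function is `0` or log-affine on an interval, a log-concave density exceeds
it on a subinterval. -/
lemma ordConnected_lt_and_le {q r : ℝ → ℝ} (hq : q ∈ logConcaveDensities) {T : Set ℝ}
    (hT : T.OrdConnected)
    (hr : (∀ x ∈ T, r x = 0) ∨ ∃ a b : ℝ, ∀ x ∈ T, r x = Real.exp (a * x + b)) :
    ({x | r x < q x} ∩ T).OrdConnected ∧ ({x | r x ≤ q x} ∩ T).OrdConnected := by
  obtain ⟨⟨hq0, -⟩, -, hJ, -, hconc⟩ := hq
  rcases hr with hr | ⟨a, b, hr⟩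
  · constructor
    · refine ⟨fun x hx y hy z hz => ?_⟩
      have hzT := hT.out hx.2 hy.2 hz
      refine ⟨?_, hzT⟩
      have h1 : 0 < q x := by simpa [hr x hx.2] using hx.1
      have h2 : 0 < q y := by simpa [hr y hy.2] using hy.1
      simpa [hr z hzT] using hJ.out h1 h2 hz
    · refine ⟨fun x hx y hy z hz => ?_⟩
      have hzT := hT.out hx.2 hy.2 hz
      exact ⟨by simpa [hr z hzT] using hq0 z, hzT⟩
  · have key : ∀ x ∈ T, ∀ y ∈ T, r x ≤ q x → r y ≤ q y → ∀ z ∈ Set.Icc x y, 0 < q z ∧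
        ∃ s t : ℝ, 0 ≤ s ∧ 0 ≤ t ∧ s + t = 1 ∧ s * (Real.log (q x) - (a * x + b)) +
          t * (Real.log (q y) - (a * y + b)) ≤ Real.log (q z) - (a * z + b) := by
      intro x hx y hy hxq hyq z hz
      have h1 : 0 < q x := (Real.exp_pos _).trans_le (hr x hx ▸ hxq)
      have h2 : 0 < q y := (Real.exp_pos _).trans_le (hr y hy ▸ hyq)
      refine ⟨hJ.out h1 h2 hz, ?_⟩
      have hz' : z ∈ segment ℝ x y := by rwa [segment_eq_Icc (hz.1.trans hz.2)]
      obtain ⟨s, t, hs, ht, hst, rfl⟩ := hz'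
      refine ⟨s, t, hs, ht, hst, ?_⟩
      have := hconc.2 h1 h2 hs ht hst
      simp only [smul_eq_mul] at this ⊢
      have e : a * (s * x + t * y) + b = s * (a * x + b) + t * (a * y + b) := by
        linear_combination (-b) * hst
      rw [e]
      linarith
    constructor
    · refine ⟨fun x hx y hy z hz => ?_⟩
      have hzT := hT.out hx.2 hy.2 hz
      obtain ⟨h0, s, t, hs, ht, hst, h⟩ := key x hx.2 y hy.2 hx.1.le hy.1.le z hz
      refine ⟨?_, hzT⟩
      have h1 : a * x + b < Real.log (q x) := by
        have h : r x < q x := hx.1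
        rw [hr x hx.2] at h
        exact (Real.lt_log_iff_exp_lt ((Real.exp_pos _).trans h)).2 h
      have h2 : a * y + b < Real.log (q y) := by
        have h : r y < q y := hy.1
        rw [hr y hy.2] at h
        exact (Real.lt_log_iff_exp_lt ((Real.exp_pos _).trans h)).2 h
      change r z < q z
      rw [hr z hzT, ← Real.lt_log_iff_exp_lt h0]
      have h3 : 0 < s * (Real.log (q x) - (a * x + b)) + t * (Real.log (q y) - (a * y + b)) := by
        rcases hs.lt_or_eq with hs | rfl
        · exact add_pos_of_pos_of_nonneg (mul_pos hs (sub_pos.2 h1))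
            (mul_nonneg ht (sub_pos.2 h2).le)
        · have : t = 1 := by linarith
          subst this; linarith
      linarith
    · refine ⟨fun x hx y hy z hz => ?_⟩
      have hzT := hT.out hx.2 hy.2 hz
      obtain ⟨h0, s, t, hs, ht, hst, h⟩ := key x hx.2 y hy.2 hx.1 hy.1 z hz
      refine ⟨?_, hzT⟩
      have h1 : a * x + b ≤ Real.log (q x) := by
        have h : r x ≤ q x := hx.1
        rw [hr x hx.2] at h
        exact (Real.le_log_iff_exp_le ((Real.exp_pos _).trans_le h)).2 h
      have h2 : a * y + b ≤ Real.log (q y) := by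
        have h : r y ≤ q y := hy.1
        rw [hr y hy.2] at h
        exact (Real.le_log_iff_exp_le ((Real.exp_pos _).trans_le h)).2 h
      change r z ≤ q z
      rw [hr z hzT, ← Real.le_log_iff_exp_le h0]
      have h3 := mul_nonneg hs (sub_nonneg.2 h1)
      have h4 := mul_nonneg ht (sub_nonneg.2 h2)
      linarith

/-- The number of points of `A` below `x`: it labels the pieces into which `A` cuts the line. -/
noncomputable def pieceIndex (A : Finset ℝ) (x : ℝ) : Fin (A.card + 1) :=
  ⟨(A.filter (· < x)).card, Nat.lt_succ_of_le (Finset.card_filter_le _ _)⟩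

lemma lt_iff_of_pieceIndex_eq {A : Finset ℝ} {x y : ℝ} (h : pieceIndex A x = pieceIndex A y)
    {a : ℝ} (ha : a ∈ A) : a < x ↔ a < y := by
  have hc : (A.filter (· < x)).card = (A.filter (· < y)).card := congrArg Fin.val h
  have : A.filter (· < x) = A.filter (· < y) := by
    rcases le_total x y with hxy | hxy
    · exact Finset.eq_of_subset_of_card_le
        (Finset.monotone_filter_right _ fun b _ hb => lt_of_lt_of_le hb hxy) hc.ge
    · exact (Finset.eq_of_subset_of_card_le
        (Finset.monotone_filter_right _ fun b _ hb => lt_of_lt_of_le hb hxy) hc.le).symm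
  have h2 := Finset.ext_iff.1 this a
  simpa [ha] using h2

lemma ordConnected_piece (A : Finset ℝ) (j : Fin (A.card + 1)) :
    ((A : Set ℝ)ᶜ ∩ pieceIndex A ⁻¹' {j}).OrdConnected := by
  refine ⟨fun x hx y hy z hz => ?_⟩
  have hxy : pieceIndex A x = pieceIndex A y := hx.2.trans hy.2.symm
  have hzA : z ∉ A := fun h => by
    have hxz : z ≠ x := by rintro rfl; exact hx.1 h
    have hyz : z ≠ y := by rintro rfl; exact hy.1 h
    exact absurd ((lt_iff_of_pieceIndex_eq hxy h).2 (lt_of_le_of_ne hz.2 hyz)) (not_lt.2 hz.1)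
  refine ⟨hzA, ?_⟩
  rw [Set.mem_preimage, Set.mem_singleton_iff, ← Set.mem_singleton_iff.1 hx.2]
  refine Fin.ext ?_
  refine congrArg Finset.card (Finset.filter_congr fun a ha => ?_)
  exact ⟨fun h => (lt_iff_of_pieceIndex_eq hxy ha).2 (h.trans_le hz.2), fun h => h.trans_le hz.1⟩

lemma piece_dichotomy {A : Finset ℝ} {r : ℝ → ℝ}
    (hr : ∀ I ∈ openPieces A,
      (∀ x ∈ I, r x = 0) ∨ ∃ a b : ℝ, ∀ x ∈ I, r x = Real.exp (a * x + b))
    (j : Fin (A.card + 1)) :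
    (∀ x ∈ (A : Set ℝ)ᶜ ∩ pieceIndex A ⁻¹' {j}, r x = 0) ∨
      ∃ a b : ℝ, ∀ x ∈ (A : Set ℝ)ᶜ ∩ pieceIndex A ⁻¹' {j}, r x = Real.exp (a * x + b) := by
  rcases Set.eq_empty_or_nonempty ((A : Set ℝ)ᶜ ∩ pieceIndex A ⁻¹' {j}) with h | ⟨x, hx⟩
  · left; simp [h]
  · have hsub : ∀ y ∈ (A : Set ℝ)ᶜ ∩ pieceIndex A ⁻¹' {j},
        y ∈ {y | ∀ a ∈ A, (a < y ↔ a < x) ∧ (y < a ↔ x < a)} := by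
      intro y hy a ha
      have h1 := lt_iff_of_pieceIndex_eq (hy.2.trans hx.2.symm) ha
      refine ⟨h1, ?_⟩
      have hya : y ≠ a := by rintro rfl; exact hy.1 ha
      have hxa : x ≠ a := by rintro rfl; exact hx.1 ha
      rw [← not_le, ← not_le, hya.symm.le_iff_lt, hxa.symm.le_iff_lt, h1]
    rcases hr _ ⟨x, hx.1, rfl⟩ with h | ⟨a, b, h⟩
    · exact Or.inl fun y hy => h y (hsub y hy)
    · exact Or.inr ⟨a, b, fun y hy => h y (hsub y hy)⟩

/-! ### The oracle inequality for TV-estimators -/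

lemma tvStatPair_eq {n : ℕ} (x : Fin n → ℝ) (p q : ℝ → ℝ) :
    tvStatPair x p q = (∑ i, Set.indicator {y | p y < q y} (fun _ => (1 : ℝ)) (x i)) -
      n * (densityMeasure p).real {y | p y < q y} := by
  simp [tvStatPair, tvTest, Finset.sum_sub_distrib]

lemma bddAbove_tvStatPair {n : ℕ} (x : Fin n → ℝ) (p : ℝ → ℝ) (M : Set (ℝ → ℝ)) :
    BddAbove (Set.range fun q : M => tvStatPair x p q) := by
  refine ⟨n, ?_⟩
  rintro _ ⟨q, rfl⟩
  simp only [tvStatPair_eq]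
  have h1 : ∑ i, Set.indicator {y | p y < q.1 y} (fun _ => (1 : ℝ)) (x i) ≤ ∑ _i : Fin n, (1 : ℝ) :=
    Finset.sum_le_sum fun i _ =>
      Set.indicator_le_self' (f := fun _ => (1 : ℝ)) (fun _ _ => zero_le_one) _
  have h2 : 0 ≤ n * (densityMeasure p).real {y | p y < q.1 y} := by positivity
  simp only [Finset.sum_const, Finset.card_univ, Fintype.card_fin, nsmul_eq_mul, mul_one] at h1
  linarith

lemma tvStat_nonneg {n : ℕ} (x : Fin n → ℝ) {M : Set (ℝ → ℝ)} {p : ℝ → ℝ} (hp : p ∈ M) :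
    0 ≤ tvStat M x p := by
  refine le_trans (le_of_eq ?_) (le_ciSup (bddAbove_tvStatPair x p M) ⟨p, hp⟩)
  simp [tvStatPair_eq]

/-- The supremum over `q ∈ M` of the centred empirical measure of the sets `C q`. -/
noncomputable def empiricalSup {n : ℕ} (p : ℝ → ℝ) (M : Set (ℝ → ℝ)) (C : M → Set ℝ)
    (x : Fin n → ℝ) : ℝ :=
  ⨆ q : M, ∑ i, ((C q).indicator (fun _ => (1 : ℝ)) (x i) - (densityMeasure p).real (C q))

lemma le_empiricalSup {n : ℕ} {p : ℝ → ℝ} {M : Set (ℝ → ℝ)} (C : M → Set ℝ)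
    (x : Fin n → ℝ) (q : M) :
    (∑ i, (C q).indicator (fun _ => (1 : ℝ)) (x i)) - n * (densityMeasure p).real (C q) ≤
      empiricalSup p M C x := by
  have hb : BddAbove (Set.range fun q : M =>
      ∑ i, ((C q).indicator (fun _ => (1 : ℝ)) (x i) - (densityMeasure p).real (C q))) := by
    refine ⟨∑ _i : Fin n, (1 : ℝ), ?_⟩
    rintro _ ⟨q, rfl⟩
    refine Finset.sum_le_sum fun i _ => ?_
    have h1 : (C q).indicator (fun _ => (1 : ℝ)) (x i) ≤ 1 :=
      Set.indicator_le_self' (f := fun _ => (1 : ℝ)) (fun _ _ => zero_le_one) _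
    have h2 : 0 ≤ (densityMeasure p).real (C q) := measureReal_nonneg
    linarith
  refine le_trans (le_of_eq ?_) (le_ciSup hb q)
  simp [Finset.sum_sub_distrib]

/-- The deterministic part of the analysis: the loss of an `ε`-minimizer is controlled by the
distance to any element `r` of the model and by two empirical suprema attached to `r`. -/
lemma l1Norm_sub_le_of_mem_tvMinimizers {n : ℕ} (hn : 1 ≤ n) {p : ℝ → ℝ} (hp : IsDensity p)
    {M : Set (ℝ → ℝ)} (hM : M ⊆ logConcaveDensities) {ε : ℝ} {r q : ℝ → ℝ} (hr : r ∈ M)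
    {x : Fin n → ℝ} (hq : q ∈ tvMinimizers M ε x) (A : Finset ℝ) (hx : ∀ i, x i ∉ A) :
    l1Norm (p - q) ≤ 3 * l1Norm (p - r) + 2 / n *
      (empiricalSup p M (fun q => {y | r y < q.1 y} \ A) x +
        empiricalSup p M (fun q => {y | r y ≤ q.1 y} \ A) x + ε) := by
  have hrd := (hM hr).1
  have hqd := (hM hq.1).1
  have hmr := measurable_of_mem_logConcaveDensities (hM hr)
  have hmq := measurable_of_mem_logConcaveDensities (hM hq.1)
  have hprob := isProbabilityMeasure_densityMeasure hp
  have hA : densityMeasure p A = 0 := densityMeasure_finset p A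
  have hind : ∀ (S : Set ℝ) i, (S \ A).indicator (fun _ => (1 : ℝ)) (x i) =
      S.indicator (fun _ => (1 : ℝ)) (x i) := by
    intro S i
    by_cases h : x i ∈ S
    · rw [Set.indicator_of_mem h, Set.indicator_of_mem (show x i ∈ S \ A from ⟨h, hx i⟩)]
    · rw [Set.indicator_of_notMem h, Set.indicator_of_notMem fun h' => h h'.1]
  have hmeas : ∀ S : Set ℝ, (densityMeasure p).real (S \ A) = (densityMeasure p).real S := by
    intro S
    rw [measureReal_def, measureReal_def, measure_sdiff_null hA]
  -- upper bound of the statistic at `r`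
  have hup : tvStat M x r ≤ empiricalSup p M (fun q => {y | r y < q.1 y} \ A) x +
      n * (l1Norm (p - r) / 2) := by
    have : Nonempty M := ⟨⟨r, hr⟩⟩
    refine ciSup_le fun q' => ?_
    have h1 := le_empiricalSup (n := n) (p := p) (fun q : M => {y | r y < q.1 y} \ (A : Set ℝ)) x q'
    simp only [hind, hmeas] at h1
    have hmq' := measurable_of_mem_logConcaveDensities (hM q'.2)
    have h2 := densityMeasure_real_sub_le hp hrd (measurableSet_lt hmr hmq')
    rw [tvStatPair_eq]
    have h3 := mul_le_mul_of_nonneg_left h2 (Nat.cast_nonneg (α := ℝ) n)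
    linarith
  -- lower bound of the statistic at the estimator
  have hlow : n * (l1Norm (r - q) / 2 - l1Norm (p - r) / 2) -
      empiricalSup p M (fun q => {y | r y ≤ q.1 y} \ A) x ≤ tvStat M x q := by
    refine le_trans ?_ (le_ciSup (bddAbove_tvStatPair x q M) ⟨r, hr⟩)
    have h1 := le_empiricalSup (n := n) (p := p) (fun q : M => {y | r y ≤ q.1 y} \ (A : Set ℝ)) x
      ⟨q, hq.1⟩
    simp only [hind, hmeas] at h1
    have hS : MeasurableSet {y | q y < r y} := measurableSet_lt hmq hmr
    have hcompl : {y | r y ≤ q y} = {y | q y < r y}ᶜ := by ext y; simp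
    have h2 : ∑ i, Set.indicator {y | r y ≤ q y} (fun _ => (1 : ℝ)) (x i) =
        n - ∑ i, Set.indicator {y | q y < r y} (fun _ => (1 : ℝ)) (x i) := by
      rw [hcompl, eq_sub_iff_add_eq, ← Finset.sum_add_distrib]
      simp only [Set.indicator_compl_add_self_apply]
      simp
    have h3 : (densityMeasure p).real {y | r y ≤ q y} =
        1 - (densityMeasure p).real {y | q y < r y} := by
      rw [hcompl, probReal_compl_eq_one_sub hS]
    rw [h2, h3] at h1
    have h4 := densityMeasure_real_sub_le hrd hp hS
    rw [l1Norm_sub_comm] at h4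
    have h5 := densityMeasure_real_sub_eq hrd hqd hS
    have h6 : l1Norm (r - q) / 2 - l1Norm (p - r) / 2 ≤
        (densityMeasure p).real {y | q y < r y} - (densityMeasure q).real {y | q y < r y} := by
      linarith
    have h7 := mul_le_mul_of_nonneg_left h6 (Nat.cast_nonneg (α := ℝ) n)
    rw [tvStatPair_eq]
    simp only
    linarith
  have hmin : tvStat M x q ≤ tvStat M x r + ε := by
    refine hq.2.trans (add_le_add_left (ciInf_le ⟨0, ?_⟩ (⟨r, hr⟩ : M)) ε)
    rintro _ ⟨p', rfl⟩
    exact tvStat_nonneg x p'.2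
  have htri := l1Norm_sub_le hp.2.1 hrd.2.1 hqd.2.1
  have hn' : (0 : ℝ) < n := by exact_mod_cast hn
  have hmain : n * (l1Norm (r - q) / 2 - l1Norm (p - r)) ≤
      empiricalSup p M (fun q => {y | r y < q.1 y} \ A) x +
        empiricalSup p M (fun q => {y | r y ≤ q.1 y} \ A) x + ε := by
    linarith
  have hdiv : l1Norm (r - q) / 2 - l1Norm (p - r) ≤
      (empiricalSup p M (fun q => {y | r y < q.1 y} \ A) x +
        empiricalSup p M (fun q => {y | r y ≤ q.1 y} \ A) x + ε) / n := by
    rw [le_div_iff₀ hn']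
    linarith
  rw [div_mul_eq_mul_div, mul_div_assoc]
  linarith

/-- Risk bound of a TV-estimator at an extremal point: the distance of the true density to any
element of the model that is log-affine on the pieces cut by `D` points enters linearly, and the
stochastic error is of order `√((D + 1) / n)`. -/
lemma risk_le_of_piecewiseLogAffine {Ω : Type*} [MeasurableSpace Ω] (P : Measure Ω)
    [IsProbabilityMeasure P] {n : ℕ} (hn : 1 ≤ n) {p : ℝ → ℝ} (hp : IsDensity p)
    {X : Fin n → Ω → ℝ} (hX : ∀ i, HasLaw (X i) (densityMeasure p) P) (hindep : iIndepFun X P)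
    {M : Set (ℝ → ℝ)} (hMc : M.Countable) (hM : M ⊆ logConcaveDensities) {ε : ℝ}
    {phat : (Fin n → ℝ) → (ℝ → ℝ)} (hphat : IsTVEstimator M ε phat) :
    Integrable (fun ω => l1Norm (p - phat (fun i => X i ω))) P ∧
      ∀ D, ∀ r ∈ M, r ∈ piecewiseLogAffineDensities D →
        ∫ ω, l1Norm (p - phat (fun i => X i ω)) ∂P ≤
          3 * l1Norm (p - r) + 32 * √((D + 1 : ℝ) / n) + 2 * ε / n := by
  have hprob := isProbabilityMeasure_densityMeasure hp
  have hAE : ∀ i, AEMeasurable (X i) P := fun i => (hX i).aemeasurable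
  have hlaw : P.map (fun ω i => X i ω) = Measure.pi fun _ : Fin n => densityMeasure p := by
    rw [(iIndepFun_iff_map_fun_eq_pi_map hAE).1 hindep]
    congr 1
    ext1 i
    exact (hX i).map_eq
  have hAE' : AEMeasurable (fun ω i => X i ω) P := aemeasurable_pi_lambda _ hAE
  set ν : Measure (Fin n → ℝ) := Measure.pi fun _ => densityMeasure p
  set F : (Fin n → ℝ) → ℝ := fun x => l1Norm (p - phat x) with hF
  have hFm : Measurable F := by
    intro B _
    have : F ⁻¹' B = ⋃ m ∈ {m ∈ M | l1Norm (p - m) ∈ B}, {x | phat x = m} := by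
      ext x
      simp only [Set.mem_preimage, Set.mem_iUnion, Set.mem_ofPred_eq, exists_prop]
      exact ⟨fun h => ⟨phat x, ⟨(hphat.mem_minimizers x).1, h⟩, rfl⟩,
        fun ⟨m, hm, hxm⟩ => by rw [hF]; simp only [hxm]; exact hm.2⟩
    rw [this]
    exact MeasurableSet.biUnion (hMc.mono fun m hm => hm.1) fun m hm => hphat.measurable m hm.1
  have hFint : Integrable F ν := by
    refine Integrable.of_bound (C := 2) hFm.aestronglyMeasurable
      (Filter.Eventually.of_forall fun x => ?_)
    rw [Real.norm_of_nonneg (l1Norm_nonneg _)]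
    exact l1Norm_sub_le_two hp (hM (hphat.mem_minimizers x).1).1
  refine ⟨(hlaw ▸ hFint : Integrable F (P.map _)).comp_aemeasurable hAE', ?_⟩
  intro D r hrM hr
  obtain ⟨hrlc, A, -, hAD, hpieces⟩ := hr
  have hEq : ∫ ω, l1Norm (p - phat (fun i => X i ω)) ∂P = ∫ x, F x ∂ν := by
    rw [← hlaw, integral_map hAE' hFm.aestronglyMeasurable]
  rw [hEq]
  have : Countable M := hMc.to_subtype
  have : Nonempty M := ⟨⟨r, hrM⟩⟩
  have hmr := measurable_of_mem_logConcaveDensities hrlc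
  obtain ⟨hi1, hZ1⟩ := integral_iSup_empirical_le (n := n) (densityMeasure p)
    (fun q : M => {y | r y < q.1 y} \ (A : Set ℝ))
    (fun q => (measurableSet_lt hmr (measurable_of_mem_logConcaveDensities (hM q.2))).diff
      A.measurableSet) (pieceIndex A) fun q j => by
      rw [Set.sdiff_eq, Set.inter_assoc]
      exact (ordConnected_lt_and_le (hM q.2) (ordConnected_piece A j)
        (piece_dichotomy hpieces j)).1
  obtain ⟨hi2, hZ2⟩ := integral_iSup_empirical_le (n := n) (densityMeasure p)
    (fun q : M => {y | r y ≤ q.1 y} \ (A : Set ℝ))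
    (fun q => (measurableSet_le hmr (measurable_of_mem_logConcaveDensities (hM q.2))).diff
      A.measurableSet) (pieceIndex A) fun q j => by
      rw [Set.sdiff_eq, Set.inter_assoc]
      exact (ordConnected_lt_and_le (hM q.2) (ordConnected_piece A j)
        (piece_dichotomy hpieces j)).2
  have hae : ∀ᵐ x ∂ν, ∀ i, x i ∉ A := by
    rw [ae_all_iff]
    intro i
    have h := (measurePreserving_eval (fun _ : Fin n => densityMeasure p) i).quasiMeasurePreserving
    exact h.ae (measure_eq_zero_iff_ae_notMem.1 (densityMeasure_finset p A))
  have hle : ∫ x, F x ∂ν ≤ ∫ x, (3 * l1Norm (p - r) + 2 / n *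
      (empiricalSup p M (fun q => {y | r y < q.1 y} \ A) x +
        empiricalSup p M (fun q => {y | r y ≤ q.1 y} \ A) x + ε)) ∂ν := by
    refine integral_mono_ae hFint ((integrable_const _).add
      (((hi1.add hi2).add (integrable_const _)).const_mul _)) ?_
    filter_upwards [hae] with x hx
    exact l1Norm_sub_le_of_mem_tvMinimizers hn hp hM hrM (hphat.mem_minimizers x) A hx
  have hn' : (0 : ℝ) < n := by exact_mod_cast hn
  have hj1 : Integrable
      (fun x => empiricalSup p M (fun q => {y | r y < q.1 y} \ (A : Set ℝ)) x) ν := hi1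
  have hj2 : Integrable
      (fun x => empiricalSup p M (fun q => {y | r y ≤ q.1 y} \ (A : Set ℝ)) x) ν := hi2
  have hcalc : ∫ x, (3 * l1Norm (p - r) + 2 / n *
      (empiricalSup p M (fun q => {y | r y < q.1 y} \ A) x +
        empiricalSup p M (fun q => {y | r y ≤ q.1 y} \ A) x + ε)) ∂ν =
      3 * l1Norm (p - r) + 2 / n *
        (∫ x, empiricalSup p M (fun q => {y | r y < q.1 y} \ A) x ∂ν +
        ∫ x, empiricalSup p M (fun q => {y | r y ≤ q.1 y} \ A) x ∂ν + ε) := by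
    have h12 : Integrable (fun x =>
        empiricalSup p M (fun q => {y | r y < q.1 y} \ (A : Set ℝ)) x +
          empiricalSup p M (fun q => {y | r y ≤ q.1 y} \ (A : Set ℝ)) x) ν := hj1.add hj2
    have h3 : Integrable (fun x => 2 / (n : ℝ) *
        (empiricalSup p M (fun q => {y | r y < q.1 y} \ (A : Set ℝ)) x +
          empiricalSup p M (fun q => {y | r y ≤ q.1 y} \ (A : Set ℝ)) x + ε)) ν :=
      (h12.add (integrable_const ε)).const_mul _
    rw [integral_add (integrable_const _) h3, integral_const_mul (2 / (n : ℝ)),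
      integral_add h12 (integrable_const _), integral_add hj1 hj2]
    simp
  have hcard : √(((A.card + 1 : ℕ) : ℝ) * n) ≤ n * √((D + 1 : ℝ) / n) := by
    have h1 : ((A.card + 1 : ℕ) : ℝ) ≤ D + 1 := by exact_mod_cast Nat.succ_le_succ hAD
    rw [← Real.sqrt_sq hn'.le, ← Real.sqrt_mul (sq_nonneg _), Real.sqrt_sq hn'.le]
    refine Real.sqrt_le_sqrt ?_
    have : (n : ℝ) ^ 2 * ((D + 1 : ℝ) / n) = (D + 1) * n := by field_simp
    rw [this]
    gcongr
  have hfin : 2 / n * (∫ x, empiricalSup p M (fun q => {y | r y < q.1 y} \ A) x ∂ν +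
        ∫ x, empiricalSup p M (fun q => {y | r y ≤ q.1 y} \ A) x ∂ν + ε) ≤
      2 / n * (16 * (n * √((D + 1 : ℝ) / n)) + ε) := by
    refine mul_le_mul_of_nonneg_left ?_ (by positivity)
    have h1 : ∫ x, empiricalSup p M (fun q => {y | r y < q.1 y} \ A) x ∂ν ≤ _ := hZ1
    have h2 : ∫ x, empiricalSup p M (fun q => {y | r y ≤ q.1 y} \ A) x ∂ν ≤ _ := hZ2
    linarith
  have he : 2 / n * (16 * (n * √((D + 1 : ℝ) / n)) + ε) =
      32 * √((D + 1 : ℝ) / n) + 2 * ε / n := by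
    field_simp
    ring
  linarith

/-! ### Minima of finitely many affine functions -/

/-- The minimum of the constant `k` and of the affine functions `x ↦ q.1 * x + q.2`, `q ∈ S`. -/
noncomputable def affineMin (k : ℝ) (S : Finset (ℝ × ℝ)) (x : ℝ) : ℝ :=
  S.fold min k fun q => q.1 * x + q.2

lemma le_affineMin {k : ℝ} {S : Finset (ℝ × ℝ)} {x t : ℝ} :
    t ≤ affineMin k S x ↔ t ≤ k ∧ ∀ q ∈ S, t ≤ q.1 * x + q.2 :=
  Finset.le_fold_min _

lemma affineMin_le_const (k : ℝ) (S : Finset (ℝ × ℝ)) (x : ℝ) : affineMin k S x ≤ k :=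
  (le_affineMin.1 le_rfl).1

lemma affineMin_le {k : ℝ} {S : Finset (ℝ × ℝ)} {q : ℝ × ℝ} (hq : q ∈ S) (x : ℝ) :
    affineMin k S x ≤ q.1 * x + q.2 :=
  (le_affineMin.1 le_rfl).2 q hq

lemma exists_affineMin_eq (k : ℝ) (S : Finset (ℝ × ℝ)) (x : ℝ) :
    ∃ q ∈ insert ((0 : ℝ), k) S, affineMin k S x = q.1 * x + q.2 := by
  classical
  induction S using Finset.induction_on with
  | empty => exact ⟨(0, k), by simp, by simp [affineMin]⟩
  | insert a S ha ih =>
    obtain ⟨q, hq, h⟩ := ih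
    have e : affineMin k (insert a S) x = min (a.1 * x + a.2) (affineMin k S x) :=
      Finset.fold_insert ha
    rcases min_choice (a.1 * x + a.2) (affineMin k S x) with h' | h'
    · exact ⟨a, by simp, by rw [e, h']⟩
    · refine ⟨q, ?_, by rw [e, h', h]⟩
      simp only [Finset.mem_insert] at hq ⊢
      tauto

lemma affineMin_le_of_mem_insert {k : ℝ} {S : Finset (ℝ × ℝ)} {q : ℝ × ℝ}
    (hq : q ∈ insert ((0 : ℝ), k) S) (x : ℝ) : affineMin k S x ≤ q.1 * x + q.2 := by
  rcases Finset.mem_insert.1 hq with rfl | hq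
  · simpa using affineMin_le_const k S x
  · exact affineMin_le hq x

lemma concaveOn_affineMin (k : ℝ) (S : Finset (ℝ × ℝ)) : ConcaveOn ℝ Set.univ (affineMin k S) := by
  refine ⟨convex_univ, fun x _ y _ s t hs ht hst => ?_⟩
  simp only [smul_eq_mul]
  refine le_affineMin.2 ⟨?_, fun q hq => ?_⟩
  · calc s * affineMin k S x + t * affineMin k S y ≤ s * k + t * k :=
          add_le_add (mul_le_mul_of_nonneg_left (affineMin_le_const k S x) hs)
            (mul_le_mul_of_nonneg_left (affineMin_le_const k S y) ht)
      _ = k := by rw [← add_mul, hst, one_mul]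
  · calc s * affineMin k S x + t * affineMin k S y ≤
          s * (q.1 * x + q.2) + t * (q.1 * y + q.2) :=
          add_le_add (mul_le_mul_of_nonneg_left (affineMin_le hq x) hs)
            (mul_le_mul_of_nonneg_left (affineMin_le hq y) ht)
      _ = q.1 * (s * x + t * y) + q.2 := by linear_combination q.2 * hst

lemma continuous_affineMin (k : ℝ) (S : Finset (ℝ × ℝ)) : Continuous (affineMin k S) := by
  classical
  induction S using Finset.induction_on with
  | empty => exact continuous_const
  | insert a S ha ih =>
    have e : affineMin k (insert a S) = fun x => min (a.1 * x + a.2) (affineMin k S x) :=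
      funext fun x => Finset.fold_insert ha
    rw [e]
    exact ((continuous_const.mul continuous_id).add continuous_const).min ih

/-- The right end points of the intervals on which one of the affine functions attains the
minimum. -/
noncomputable def affineMinKinks (k : ℝ) (S : Finset (ℝ × ℝ)) : Finset ℝ :=
  (insert ((0 : ℝ), k) S).image fun q => sSup {x | affineMin k S x = q.1 * x + q.2}

/-- On an interval without kinks the minimum is a single affine function: the set where a given
function attains the minimum extends to the right end of the interval, and two affine functions
that agree on an interval coincide. -/
lemma exists_affineMin_eqOn (k : ℝ) (S : Finset (ℝ × ℝ)) {I : Set ℝ} (hI : I.OrdConnected)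
    (hIo : IsOpen I) (hk : ∀ a ∈ affineMinKinks k S, a ∉ I) :
    ∃ q : ℝ × ℝ, ∀ x ∈ I, affineMin k S x = q.1 * x + q.2 := by
  rcases I.eq_empty_or_nonempty with rfl | ⟨x₀, hx₀⟩
  · exact ⟨(0, 0), by simp⟩
  have key : ∀ q ∈ insert ((0 : ℝ), k) S, ∀ x ∈ I, affineMin k S x = q.1 * x + q.2 →
      ∀ y ∈ I, x ≤ y → affineMin k S y = q.1 * y + q.2 := by
    intro q hq x hx hxq y hy hxy
    set E := {x | affineMin k S x = q.1 * x + q.2} with hE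
    have hEconv : ∀ z ∈ E, y ≤ z → y ∈ E := by
      intro z hz hyz
      refine le_antisymm (affineMin_le_of_mem_insert hq y) ?_
      have hy' : y ∈ segment ℝ x z := by
        rw [segment_eq_Icc (hxy.trans hyz)]; exact ⟨hxy, hyz⟩
      obtain ⟨s, t, hs, ht, hst, rfl⟩ := hy'
      have := (concaveOn_affineMin k S).2 (Set.mem_univ x) (Set.mem_univ z) hs ht hst
      simp only [smul_eq_mul] at this ⊢
      rw [hxq, show affineMin k S z = q.1 * z + q.2 from hz] at this
      linear_combination this - q.2 * hst
    by_contra hyE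
    -- otherwise `y` bounds `E`, and the supremum of `E` is a kink between `x` and `y`
    have hub : ∀ z ∈ E, z ≤ y := fun z hz => by
      by_contra h
      exact hyE (hEconv z hz (not_le.1 h).le)
    have h1 : x ≤ sSup E := le_csSup ⟨y, hub⟩ hxq
    have h2 : sSup E ≤ y := csSup_le ⟨x, hxq⟩ hub
    exact hk (sSup E) (Finset.mem_image_of_mem _ hq) (hI.out hx hy ⟨h1, h2⟩)
  obtain ⟨q, hq, h⟩ := exists_affineMin_eq k S x₀
  obtain ⟨e, he, hball⟩ := Metric.isOpen_iff.1 hIo x₀ hx₀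
  have hx₁ : x₀ + e / 2 ∈ I := hball (by simp [abs_of_pos he, he])
  refine ⟨q, fun x hx => ?_⟩
  rcases le_total x₀ x with hxx | hxx
  · exact key q hq x₀ hx₀ h x hx hxx
  · obtain ⟨q', hq', h'⟩ := exists_affineMin_eq k S x
    have e0 := key q' hq' x hx h' x₀ hx₀ hxx
    have e1 := key q' hq' x hx h' _ hx₁ (by linarith)
    have e2 := key q hq x₀ hx₀ h _ hx₁ (by linarith)
    have h1 : q'.1 = q.1 := by
      have : (q'.1 - q.1) * (e / 2) = 0 := by linarith
      rcases mul_eq_zero.1 this with h | h <;> linarith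
    have h2 : q'.2 = q.2 := by rw [h1] at e0; linarith
    rw [h', h1, h2]

/-- The exponential of a minimum of affine functions on a bounded interval, normalized to a
density, is a piecewise log-affine density. -/
lemma affineMin_mem_piecewiseLogAffineDensities {k a b I : ℝ} (S : Finset (ℝ × ℝ)) (hI : 0 < I)
    (hint : Integrable ((Set.Ioo a b).indicator fun x => Real.exp (affineMin k S x)))
    (hmass : ∫ x, (Set.Ioo a b).indicator (fun x => Real.exp (affineMin k S x)) x = I) :
    (fun x => (Set.Ioo a b).indicator (fun x => Real.exp (affineMin k S x)) x / I) ∈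
      piecewiseLogAffineDensities (S.card + 3) := by
  set f : ℝ → ℝ := (Set.Ioo a b).indicator fun x => Real.exp (affineMin k S x) with hf
  have hfin : ∀ x ∈ Set.Ioo a b, f x / I = Real.exp (affineMin k S x - Real.log I) := by
    intro x hx
    rw [hf, Set.indicator_of_mem hx, Real.exp_sub, Real.exp_log hI]
  have hfout : ∀ x, x ∉ Set.Ioo a b → f x / I = 0 := by
    intro x hx
    rw [hf, Set.indicator_of_notMem hx, zero_div]
  have hJ : {x | 0 < f x / I} = Set.Ioo a b := by
    ext x
    by_cases hx : x ∈ Set.Ioo a b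
    · simp only [Set.mem_ofPred_eq, hfin x hx, hx, Real.exp_pos]
    · simp [hfout x hx, hx]
  have hlog : ∀ x ∈ Set.Ioo a b, Real.log (f x / I) = affineMin k S x - Real.log I := by
    intro x hx
    rw [hfin x hx, Real.log_exp]
  refine ⟨⟨⟨fun x => ?_, hint.div_const I, ?_⟩, ?_, ?_, ?_, ?_⟩, ?_⟩
  · exact div_nonneg (Set.indicator_nonneg (fun _ _ => (Real.exp_pos _).le) x) hI.le
  · rw [integral_div, hmass, div_self hI.ne']
  · rw [hJ]; exact isOpen_Ioo
  · rw [hJ]; exact Set.ordConnected_Ioo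
  · rw [hJ]
    exact (((continuous_affineMin k S).sub continuous_const).continuousOn).congr hlog
  · rw [hJ]
    have h1 : ConcaveOn ℝ (Set.Ioo a b) fun x => affineMin k S x + -Real.log I :=
      ((concaveOn_affineMin k S).subset (Set.subset_univ _) (convex_Ioo a b)).add_const _
    refine h1.congr fun x hx => ?_
    simp only
    rw [hlog x hx, sub_eq_add_neg]
  · refine ⟨insert a (insert b (affineMinKinks k S)), ⟨a, by simp⟩, ?_, ?_⟩
    · have h1 : (affineMinKinks k S).card ≤ S.card + 1 :=
        Finset.card_image_le.trans (Finset.card_insert_le _ _)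
      have h2 := Finset.card_insert_le b (affineMinKinks k S)
      have h3 := Finset.card_insert_le a (insert b (affineMinKinks k S))
      omega
    · rintro _ ⟨x, hx, rfl⟩
      set A := insert a (insert b (affineMinKinks k S)) with hA
      set T := {y | ∀ a ∈ A, (a < y ↔ a < x) ∧ (y < a ↔ x < a)} with hT
      have hTA : ∀ c ∈ A, c ∉ T := by
        intro c hc hcT
        have h := hcT c hc
        have : c ≠ x := by rintro rfl; exact hx hc
        rcases lt_or_gt_of_ne this with h' | h'
        · exact lt_irrefl _ (h.1.2 h')
        · exact lt_irrefl _ (h.2.2 h')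
      have hTc : T.OrdConnected := by
        refine ⟨fun u hu v hv w hw c hc => ?_⟩
        have h1 := hu c hc
        have h2 := hv c hc
        exact ⟨⟨fun h => h2.1.1 (h.trans_le hw.2), fun h => (h1.1.2 h).trans_le hw.1⟩,
          ⟨fun h => h1.2.1 (hw.1.trans_lt h), fun h => hw.2.trans_lt (h2.2.2 h)⟩⟩
      have hTo : IsOpen T := by
        have : T = ⋂ c ∈ A, {y | (c < y ↔ c < x) ∧ (y < c ↔ x < c)} := by
          ext y; simp [hT]
        rw [this]
        refine isOpen_biInter_finset fun c hc => ?_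
        have hcx : c ≠ x := by rintro rfl; exact hx hc
        rcases lt_or_gt_of_ne hcx with h' | h'
        · have : {y | (c < y ↔ c < x) ∧ (y < c ↔ x < c)} = Set.Ioi c := by
            ext y
            simp only [Set.mem_ofPred_eq, Set.mem_Ioi, h', iff_true, not_lt.2 h'.le, iff_false,
              not_lt]
            exact ⟨fun h => h.1, fun h => ⟨h, h.le⟩⟩
          rw [this]; exact isOpen_Ioi
        · have : {y | (c < y ↔ c < x) ∧ (y < c ↔ x < c)} = Set.Iio c := by
            ext y
            simp only [Set.mem_ofPred_eq, Set.mem_Iio, h', iff_true, not_lt.2 h'.le, iff_false,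
              not_lt]
            exact ⟨fun h => h.2, fun h => ⟨h.le, h⟩⟩
          rw [this]; exact isOpen_Iio
      by_cases hxI : x ∈ Set.Ioo a b
      · right
        obtain ⟨q, hq⟩ := exists_affineMin_eqOn k S hTc hTo fun c hc => hTA c (by simp [hA, hc])
        refine ⟨q.1, q.2 - Real.log I, fun y hy => ?_⟩
        have hyI : y ∈ Set.Ioo a b :=
          ⟨(hy a (by simp [hA])).1.2 hxI.1, (hy b (by simp [hA])).2.2 hxI.2⟩
        change f y / I = _
        rw [hfin y hyI, hq y hy, add_sub_assoc]
      · left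
        intro y hy
        refine hfout y fun hyI => hxI ?_
        exact ⟨(hy a (by simp [hA])).1.1 hyI.1, (hy b (by simp [hA])).2.1 hyI.2⟩

/-! ### Chords of the level function of one tail -/

/-- The tail of a log-concave function `p` to the right of a mode `x₀`, described by its level
function: `β y` is the right end point of the superlevel set `{p > c * exp (-y)}`, with `c` the
supremum of `p`. Up to reversing the axes, `β` is the graph of `log (p / c)`; unlike the latter it
is finite everywhere and insensitive to jumps of `p` at the end of its support. -/
structure IsTailProfile (p : ℝ → ℝ) (c x₀ : ℝ) (β : ℝ → ℝ) : Prop where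
  pos : 0 < c
  nonneg : ∀ x, 0 ≤ p x
  le_top : ∀ x, p x ≤ c
  concave : ConcaveOn ℝ (Set.Ioi 0) β
  mono : MonotoneOn β (Set.Ioi 0)
  le_level : ∀ y, 0 < y → x₀ ≤ β y
  le_apply : ∀ y, 0 < y → ∀ x, x₀ < x → x < β y → c * Real.exp (-y) ≤ p x
  apply_le : ∀ y, 0 < y → ∀ x, β y < x → p x ≤ c * Real.exp (-y)

lemma ConcaveOn.three_point {β : ℝ → ℝ} (hβ : ConcaveOn ℝ (Set.Ioi 0) β) {u v w : ℝ} (hu : 0 < u)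
    (huv : u < v) (hvw : v < w) : (β w - β v) * (v - u) ≤ (β v - β u) * (w - v) := by
  have h := hβ.slope_anti_adjacent hu (show w ∈ Set.Ioi 0 from hu.trans (huv.trans hvw)) huv hvw
  rwa [div_le_div_iff₀ (sub_pos.2 hvw) (sub_pos.2 huv)] at h

lemma le_mul_exp_neg_of_forall_lt {P c a y : ℝ} (hay : a < y)
    (h : ∀ y', a < y' → y' < y → P ≤ c * Real.exp (-y')) : P ≤ c * Real.exp (-y) := by
  have ht : Filter.Tendsto (fun y' => c * Real.exp (-y')) (nhdsWithin y (Set.Iio y))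
      (nhds (c * Real.exp (-y))) :=
    (Continuous.tendsto (by fun_prop) y).mono_left nhdsWithin_le_nhds
  refine ge_of_tendsto ht ?_
  filter_upwards [Ioo_mem_nhdsLT hay] with y' hy' using h y' hy'.1 hy'.2

lemma mul_exp_neg_le_of_forall_gt {P c b y : ℝ} (hyb : y < b)
    (h : ∀ y', y < y' → y' < b → c * Real.exp (-y') ≤ P) : c * Real.exp (-y) ≤ P := by
  have ht : Filter.Tendsto (fun y' => c * Real.exp (-y')) (nhdsWithin y (Set.Ioi y))
      (nhds (c * Real.exp (-y))) :=
    (Continuous.tendsto (by fun_prop) y).mono_left nhdsWithin_le_nhds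
  refine le_of_tendsto ht ?_
  filter_upwards [Ioo_mem_nhdsGT hyb] with y' hy' using h y' hy'.1 hy'.2

/-- The affine function of `x` through the points `(β u, -u)` and `(β v, -v)`. -/
noncomputable def chordLine (β : ℝ → ℝ) (u v x : ℝ) : ℝ :=
  -u - (x - β u) * ((v - u) / (β v - β u))

lemma chordLine_mul {β : ℝ → ℝ} {u v : ℝ} (h : β u < β v) (x : ℝ) :
    (-chordLine β u v x - u) * (β v - β u) = (x - β u) * (v - u) := by
  have : β v - β u ≠ 0 := (sub_pos.2 h).ne'
  rw [chordLine]
  field_simp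
  ring

lemma chordLine_eq_right {β : ℝ → ℝ} {u v : ℝ} (h : β u < β v) (x : ℝ) :
    chordLine β u v x = -v - (x - β v) * ((v - u) / (β v - β u)) := by
  have : β v - β u ≠ 0 := (sub_pos.2 h).ne'
  rw [chordLine]
  field_simp
  ring

namespace IsTailProfile

variable {p β : ℝ → ℝ} {c x₀ u v w x : ℝ}

/-- Over its own interval a chord lies below the log-density. -/
lemma chordLine_le (hp : IsTailProfile p c x₀ β) (hu : 0 < u) (huv : u < v) (h1 : β u < x)
    (h2 : x < β v) : c * Real.exp (chordLine β u v x) ≤ p x := by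
  have hβ := h1.trans h2
  have hmul := chordLine_mul hβ x
  set y := -chordLine β u v x with hy
  have hΔ := sub_pos.2 hβ
  have hh := sub_pos.2 huv
  rw [show chordLine β u v x = -y by rw [hy, neg_neg]]
  have hyv : y < v := by nlinarith
  have hyu : u < y := by nlinarith
  refine mul_exp_neg_le_of_forall_gt hyv fun y' h3 h4 => ?_
  refine hp.le_apply y' (by linarith) x ((hp.le_level u hu).trans_lt h1) ?_
  have := hp.concave.three_point hu (hyu.trans h3) h4
  by_contra hcon
  nlinarith

/-- Off its own interval a chord lies above the log-density. -/
lemma le_chordLine (hp : IsTailProfile p c x₀ β) (hu : 0 < u) (huv : u < v) (hβ : β u < β v)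
    (hx : x ≤ β u ∨ β v < x) : p x ≤ c * Real.exp (chordLine β u v x) := by
  have hmul := chordLine_mul hβ x
  set y := -chordLine β u v x with hy
  have hΔ := sub_pos.2 hβ
  have hh := sub_pos.2 huv
  rw [show chordLine β u v x = -y by rw [hy, neg_neg]]
  rcases hx with hx | hx
  · have hyu : y ≤ u := by nlinarith
    rcases le_or_gt y 0 with hy0 | hy0
    · refine (hp.le_top x).trans (le_mul_of_one_le_right hp.pos.le ?_)
      exact Real.one_le_exp (by linarith)
    · refine le_mul_exp_neg_of_forall_lt hy0 fun y' h3 h4 => hp.apply_le y' h3 x ?_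
      have := hp.concave.three_point h3 (h4.trans_le hyu) huv
      by_contra hcon
      nlinarith
  · have hyv : v < y := by nlinarith
    refine le_mul_exp_neg_of_forall_lt hyv fun y' h3 h4 => hp.apply_le y' (by linarith) x ?_
    have := hp.concave.three_point hu huv h3
    by_contra hcon
    nlinarith

lemma chordLine_nonneg (hp : IsTailProfile p c x₀ β) (hu : 0 < u) (huv : u < v) (hβ : β u < β v)
    (hx : x ≤ x₀) : 0 ≤ chordLine β u v x := by
  have hmul := chordLine_mul hβ x
  have hΔ := sub_pos.2 hβ
  have hh := sub_pos.2 huv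
  have key : (β v - β u) * u ≤ (β u - x) * (v - u) := by
    refine le_of_forall_pos_le_add fun e he => ?_
    set y' := min (u / 2) (e / (β v - β u)) with hy'
    have h1 : 0 < y' := lt_min (by linarith) (div_pos he hΔ)
    have h2 : y' < u := (min_le_left _ _).trans_lt (by linarith)
    have h3 : y' * (β v - β u) ≤ e := (le_div_iff₀ hΔ).1 (min_le_right _ _)
    have h4 := hp.concave.three_point h1 h2 huv
    have h5 := hp.le_level y' h1
    nlinarith
  by_contra hcon
  nlinarith

/-- The error of a chord is controlled by the decrease of the inverse slope from the preceding
chord, whose extension lies above the log-density. -/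
lemma sub_chordLine_le (hp : IsTailProfile p c x₀ β) (hu : 0 < u) (huv : u < v) (hvw : v < w)
    (h1 : β v < x) (h2 : x < β w) :
    (p x - c * Real.exp (chordLine β v w x)) * (β w - β v) ≤ c * (Real.exp (-v) * (w - v) ^ 2 *
      ((β v - β u) / (v - u) - (β w - β v) / (w - v))) := by
  have h3 := hp.concave.three_point hu huv hvw
  have hvu := sub_pos.2 huv
  have hwv := sub_pos.2 hvw
  have hΔ1 := sub_pos.2 (h1.trans h2)
  have hΔ0 : 0 < β v - β u := by
    by_contra hcon
    nlinarith [mul_pos hΔ1 hvu]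
  have hL0 := hp.le_chordLine hu huv (sub_pos.1 hΔ0) (Or.inr h1)
  have hpv := hp.apply_le v (hu.trans huv) x h1
  set d := (x - β v) * ((w - v) / (β w - β v)) - (x - β v) * ((v - u) / (β v - β u)) with hd
  have hdL : chordLine β v w x = chordLine β u v x + -d := by
    rw [chordLine_eq_right (sub_pos.1 hΔ0), chordLine, hd]; ring
  have hd0 : 0 ≤ d := by
    rw [hd, ← mul_sub]
    refine mul_nonneg (sub_pos.2 h1).le (sub_nonneg.2 ?_)
    rw [div_le_div_iff₀ hΔ0 hΔ1]
    linarith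
  have hstep : p x - c * Real.exp (chordLine β v w x) ≤ c * Real.exp (-v) * d := by
    rw [hdL, Real.exp_add, ← mul_assoc]
    have e1 : 1 - d ≤ Real.exp (-d) := by linarith [Real.add_one_le_exp (-d)]
    have e2 : p x * Real.exp (-d) ≤ c * Real.exp (chordLine β u v x) * Real.exp (-d) :=
      mul_le_mul_of_nonneg_right hL0 (Real.exp_pos _).le
    have e3 := mul_le_mul_of_nonneg_left e1 (hp.nonneg x)
    have e4 := mul_le_mul_of_nonneg_right hpv hd0
    linarith
  have hdb : d * (β w - β v) ≤
      (w - v) ^ 2 * ((β v - β u) / (v - u) - (β w - β v) / (w - v)) := by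
    set m0 := (β v - β u) / (v - u) with hm0
    set m1 := (β w - β v) / (w - v) with hm1
    have m0pos : 0 < m0 := div_pos hΔ0 hvu
    have m1pos : 0 < m1 := div_pos hΔ1 hwv
    have e0 : (v - u) / (β v - β u) = 1 / m0 := by rw [hm0, one_div_div]
    have e1 : (w - v) / (β w - β v) = 1 / m1 := by rw [hm1, one_div_div]
    have e2 : β w - β v = m1 * (w - v) := by rw [hm1]; field_simp
    have hm : m1 ≤ m0 := by
      rw [hm0, hm1, div_le_div_iff₀ hwv hvu]; linarith
    rw [hd, e0, e1, ← mul_sub, e2]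
    have hfac : 0 ≤ 1 / m1 - 1 / m0 := sub_nonneg.2 (one_div_le_one_div_of_le m1pos hm)
    calc (x - β v) * (1 / m1 - 1 / m0) * (m1 * (w - v))
        ≤ (m1 * (w - v)) * (1 / m1 - 1 / m0) * (m1 * (w - v)) := by
          have : x - β v ≤ m1 * (w - v) := by rw [← e2]; linarith
          gcongr
      _ = (w - v) ^ 2 * ((m1 / m0) * (m0 - m1)) := by field_simp
      _ ≤ (w - v) ^ 2 * (1 * (m0 - m1)) := by
          have : m1 / m0 ≤ 1 := (div_le_one m0pos).2 hm
          have : 0 ≤ m0 - m1 := sub_nonneg.2 hm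
          gcongr
      _ = _ := by ring
  calc (p x - c * Real.exp (chordLine β v w x)) * (β w - β v)
      ≤ c * Real.exp (-v) * d * (β w - β v) := mul_le_mul_of_nonneg_right hstep hΔ1.le
    _ = c * Real.exp (-v) * (d * (β w - β v)) := by ring
    _ ≤ c * Real.exp (-v) *
        ((w - v) ^ 2 * ((β v - β u) / (v - u) - (β w - β v) / (w - v))) :=
        mul_le_mul_of_nonneg_left hdb (mul_nonneg hp.pos.le (Real.exp_pos _).le)
    _ = _ := by ring

/-- Beyond `β v` the extension of a chord dominates `p`, so that the mass is at most that of an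
exponential tail. -/
lemma integral_tail_le (hp : IsTailProfile p c x₀ β) (hint : Integrable p) (hu : 0 < u)
    (huv : u < v) :
    ∫ x in Set.Ioi (β v), p x ≤ c * (Real.exp (-v) * ((β v - β u) / (v - u))) := by
  have hvu := sub_pos.2 huv
  rcases (hp.mono hu (hu.trans huv) huv.le).lt_or_eq with hβ | hβ
  · have hΔ := sub_pos.2 hβ
    set k := (v - u) / (β v - β u) with hk
    have hk0 : 0 < k := div_pos hvu hΔ
    have hle : ∀ x ∈ Set.Ioi (β v), p x ≤ c * Real.exp (-v + β v * k) * Real.exp (-k * x) := by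
      intro x hx
      refine (hp.le_chordLine hu huv hβ (Or.inr hx)).trans (le_of_eq ?_)
      rw [chordLine_eq_right hβ, mul_assoc, ← Real.exp_add]
      congr 2
      ring
    have hi : IntegrableOn (fun x => c * Real.exp (-v + β v * k) * Real.exp (-k * x))
        (Set.Ioi (β v)) := (integrableOn_exp_mul_Ioi (neg_lt_zero.2 hk0) _).const_mul _
    refine (setIntegral_mono_on hint.integrableOn hi measurableSet_Ioi hle).trans (le_of_eq ?_)
    rw [integral_const_mul, integral_exp_mul_Ioi (neg_lt_zero.2 hk0)]
    rw [show (β v - β u) / (v - u) = 1 / k by rw [hk, one_div_div], neg_div_neg_eq, Real.exp_add,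
      show -k * β v = -(β v * k) by ring, Real.exp_neg (β v * k)]
    field_simp
  · have hz : ∀ x ∈ Set.Ioi (β v), p x = 0 := by
      intro x hx
      refine le_antisymm ?_ (hp.nonneg x)
      have hall : ∀ y, v < y → p x ≤ c * Real.exp (-y) := by
        intro y hy
        refine hp.apply_le y (by linarith) x (lt_of_le_of_lt ?_ hx)
        have := hp.concave.three_point hu huv hy
        rw [hβ, sub_self, zero_mul] at this
        nlinarith
      have ht : Filter.Tendsto (fun y => c * Real.exp (-y)) Filter.atTop (nhds (c * 0)) :=
        (Real.tendsto_exp_neg_atTop_nhds_zero).const_mul c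
      rw [mul_zero] at ht
      refine ge_of_tendsto ht ?_
      filter_upwards [Filter.eventually_gt_atTop v] with y hy using hall y hy
    rw [setIntegral_congr_fun measurableSet_Ioi hz, hβ]
    simp

end IsTailProfile

/-! ### Interpolation of one tail -/

/-- The chord over the levels `u`, `v` as a pair (slope, intercept), shifted by `log c`. -/
noncomputable def chordPair (β : ℝ → ℝ) (c u v : ℝ) : ℝ × ℝ :=
  (-((v - u) / (β v - β u)), Real.log c - u + β u * ((v - u) / (β v - β u)))

lemma chordPair_apply (β : ℝ → ℝ) (c u v x : ℝ) :
    (chordPair β c u v).1 * x + (chordPair β c u v).2 = Real.log c + chordLine β u v x := by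
  simp only [chordPair, chordLine]
  ring

/-- The secant slope of `β` between consecutive levels. -/
noncomputable def levelSlope (β : ℝ → ℝ) (y : ℕ → ℝ) (i : ℕ) : ℝ :=
  (β (y (i + 1)) - β (y i)) / (y (i + 1) - y i)

/-- The chords over the level intervals `[y i, y (i + 1)]`, `1 ≤ i ≤ L`, that are not vertical. -/
noncomputable def chordSet (β : ℝ → ℝ) (c : ℝ) (y : ℕ → ℝ) (L : ℕ) : Finset (ℝ × ℝ) :=
  ((Finset.Icc 1 L).filter fun i => β (y i) < β (y (i + 1))).image
    fun i => chordPair β c (y i) (y (i + 1))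

lemma card_chordSet_le (β : ℝ → ℝ) (c : ℝ) (y : ℕ → ℝ) (L : ℕ) :
    (chordSet β c y L).card ≤ L :=
  Finset.card_image_le.trans ((Finset.card_filter_le _ _).trans (by simp))

lemma mem_chordSet {β : ℝ → ℝ} {c : ℝ} {y : ℕ → ℝ} {L : ℕ} {q : ℝ × ℝ} :
    q ∈ chordSet β c y L ↔
      ∃ i, (1 ≤ i ∧ i ≤ L) ∧ β (y i) < β (y (i + 1)) ∧ chordPair β c (y i) (y (i + 1)) = q := by
  simp [chordSet, and_assoc]

namespace IsTailProfile

variable {p β : ℝ → ℝ} {c x₀ : ℝ} {y : ℕ → ℝ} {L : ℕ}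

lemma level_pos (h0 : 0 < y 0) (hy : ∀ i ≤ L, y i < y (i + 1)) {i : ℕ} (hi : i ≤ L + 1) :
    0 < y i := by
  induction i with
  | zero => exact h0
  | succ k ih => exact (ih (by omega)).trans (hy k (by omega))

lemma level_mono (hy : ∀ i ≤ L, y i < y (i + 1)) {i j : ℕ} (hij : i ≤ j)
    (hj : j ≤ L + 1) : y i ≤ y j := by
  induction j, hij using Nat.le_induction with
  | base => exact le_rfl
  | succ k hk ih => exact (ih (by omega)).trans (hy k (by omega)).le

lemma node_mono (hp : IsTailProfile p c x₀ β) (h0 : 0 < y 0) (hy : ∀ i ≤ L, y i < y (i + 1))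
    {i j : ℕ} (hij : i ≤ j) (hj : j ≤ L + 1) : β (y i) ≤ β (y j) :=
  hp.mono (level_pos h0 hy (hij.trans hj)) (level_pos h0 hy hj) (level_mono hy hij hj)

lemma log_le_of_mem_chordSet (hp : IsTailProfile p c x₀ β) (h0 : 0 < y 0)
    (hy : ∀ i ≤ L, y i < y (i + 1)) {q : ℝ × ℝ} (hq : q ∈ chordSet β c y L) {x : ℝ}
    (hx : x ≤ x₀) : Real.log c ≤ q.1 * x + q.2 := by
  obtain ⟨i, ⟨-, hi⟩, hβ, rfl⟩ := mem_chordSet.1 hq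
  rw [chordPair_apply]
  have := hp.chordLine_nonneg (level_pos h0 hy (by omega)) (hy i hi) hβ hx
  linarith

/-- Below the first node the minimum of the chords and of the constant is the constant. -/
lemma affineMin_eq_const (hp : IsTailProfile p c x₀ β) (h0 : 0 < y 0)
    (hy : ∀ i ≤ L, y i < y (i + 1)) {x : ℝ} (hx₀ : x₀ < x) (hx : x < β (y 1)) :
    affineMin (Real.log c - y 1) (chordSet β c y L) x = Real.log c - y 1 := by
  refine le_antisymm (affineMin_le_const _ _ _) (le_affineMin.2 ⟨le_rfl, fun q hq => ?_⟩)
  obtain ⟨i, ⟨hi1, hi⟩, hβ, rfl⟩ := mem_chordSet.1 hq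
  rw [chordPair_apply]
  have h1 := hp.le_apply (y 1) (level_pos h0 hy (by omega)) x hx₀ hx
  have h2 := hp.le_chordLine (level_pos h0 hy (by omega)) (hy i hi) hβ
    (Or.inl (hx.le.trans (hp.node_mono h0 hy hi1 (by omega))))
  have h3 := Real.exp_le_exp.1 (le_of_mul_le_mul_left (h1.trans h2) hp.pos)
  linarith

/-- Between consecutive nodes the minimum is the chord over these nodes. -/
lemma affineMin_eq_chord (hp : IsTailProfile p c x₀ β) (h0 : 0 < y 0)
    (hy : ∀ i ≤ L, y i < y (i + 1)) {i : ℕ} (hi1 : 1 ≤ i) (hi : i ≤ L) {x : ℝ}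
    (hx1 : β (y i) < x) (hx2 : x < β (y (i + 1))) :
    affineMin (Real.log c - y 1) (chordSet β c y L) x =
      Real.log c + chordLine β (y i) (y (i + 1)) x := by
  have hβ := hx1.trans hx2
  have hyi := level_pos h0 hy (show i ≤ L + 1 by omega)
  refine le_antisymm ?_ (le_affineMin.2 ⟨?_, fun q hq => ?_⟩)
  · rw [← chordPair_apply]
    exact affineMin_le (mem_chordSet.2 ⟨i, ⟨hi1, hi⟩, hβ, rfl⟩) x
  · have h1 : 0 ≤ (x - β (y i)) * ((y (i + 1) - y i) / (β (y (i + 1)) - β (y i))) :=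
      mul_nonneg (sub_pos.2 hx1).le (div_nonneg (sub_pos.2 (hy i hi)).le (sub_pos.2 hβ).le)
    have h2 := level_mono hy hi1 (show i ≤ L + 1 by omega)
    rw [chordLine]
    linarith
  · obtain ⟨k, ⟨hk1, hk⟩, hβk, rfl⟩ := mem_chordSet.1 hq
    rw [chordPair_apply]
    rcases eq_or_ne k i with rfl | hki
    · exact le_rfl
    have h1 := hp.chordLine_le hyi (hy i hi) hx1 hx2
    have h2 := hp.le_chordLine (x := x) (level_pos h0 hy (show k ≤ L + 1 by omega)) (hy k hk)
      hβk (by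
      rcases lt_or_gt_of_ne hki with h | h
      · exact Or.inr ((hp.node_mono h0 hy (show k + 1 ≤ i from h) (by omega)).trans_lt hx1)
      · exact Or.inl (hx2.le.trans (hp.node_mono h0 hy (show i + 1 ≤ k from h) (by omega))))
    have h3 := Real.exp_le_exp.1 (le_of_mul_le_mul_left (h1.trans h2) hp.pos)
    linarith

/-- The `L¹`-error of the interpolation of a tail at the levels `y 1 < ⋯ < y (L + 1)`: a constant up
to the first node, chords between consecutive nodes, zero beyond the last node. -/
theorem integral_abs_sub_interpolation_le (hp : IsTailProfile p c x₀ β) (hint : Integrable p)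
    (h0 : 0 < y 0) (hy : ∀ i ≤ L, y i < y (i + 1)) :
    ∫ x in Set.Ioi x₀, |p x - (Set.Iio (β (y (L + 1)))).indicator
        (fun x => Real.exp (affineMin (Real.log c - y 1) (chordSet β c y L) x)) x| ≤
      c * ((1 - Real.exp (-y 1)) * (β (y 1) - x₀)) +
      c * ∑ i ∈ Finset.range L, Real.exp (-y (i + 1)) * (y (i + 2) - y (i + 1)) ^ 2 *
        (levelSlope β y i - levelSlope β y (i + 1)) +
      c * (Real.exp (-y (L + 1)) * levelSlope β y L) := by
  set b := β (y (L + 1)) with hb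
  set g := affineMin (Real.log c - y 1) (chordSet β c y L) with hg
  set F : ℝ → ℝ := fun x => |p x - (Set.Iio b).indicator (fun x => Real.exp (g x)) x| with hF
  have hpos1 : 0 < y 1 := level_pos h0 hy (by omega)
  have hx₀b : x₀ ≤ b := hp.le_level _ (level_pos h0 hy le_rfl)
  have hgc : Continuous fun x => Real.exp (g x) :=
    Real.continuous_exp.comp (continuous_affineMin _ _)
  have hFin : ∀ x, x < b → F x = |p x - Real.exp (g x)| := fun x hx => by
    simp only [hF]
    rw [Set.indicator_of_mem (show x ∈ Set.Iio b from hx)]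
  have hFout : ∀ x, b ≤ x → F x = p x := fun x hx => by
    simp only [hF]
    rw [Set.indicator_of_notMem (show x ∉ Set.Iio b from not_lt.2 hx), sub_zero,
      abs_of_nonneg (hp.nonneg x)]
  have hi1 : IntegrableOn F (Set.Ioc x₀ b) := by
    refine (Integrable.sub hint.integrableOn ?_).abs
    refine IntegrableOn.indicator ?_ measurableSet_Iio
    exact (hgc.integrableOn_Icc (a := x₀) (b := b)).mono_set Set.Ioc_subset_Icc_self
  have hi2 : IntegrableOn F (Set.Ioi b) :=
    (hint.integrableOn (s := Set.Ioi b)).congr_fun (fun x hx => (hFout x (le_of_lt hx)).symm)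
      measurableSet_Ioi
  have hunion : Set.Ioi x₀ = Set.Ioc x₀ b ∪ Set.Ioi b := (Set.Ioc_union_Ioi_eq_Ioi hx₀b).symm
  rw [hunion, setIntegral_union (Set.Ioc_disjoint_Ioi le_rfl) measurableSet_Ioi hi1 hi2]
  refine add_le_add ?_ ?_
  swap
  · rw [setIntegral_congr_fun measurableSet_Ioi fun x hx => hFout x (le_of_lt hx)]
    exact hp.integral_tail_le hint (level_pos h0 hy (by omega)) (hy L le_rfl)
  -- the interval up to the last node is cut at the nodes
  set z : ℕ → ℝ := fun i => if i = 0 then x₀ else β (y i) with hz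
  have hz0 : z 0 = x₀ := by simp [hz]
  have hzs : ∀ i, z (i + 1) = β (y (i + 1)) := fun i => by simp [hz]
  have hzmono : ∀ i ≤ L, z i ≤ z (i + 1) := by
    intro i hi
    rw [hzs]
    rcases Nat.eq_zero_or_pos i with rfl | h
    · rw [hz0]; exact hp.le_level _ hpos1
    · obtain ⟨k, rfl⟩ := Nat.exists_eq_succ_of_ne_zero h.ne'
      rw [Nat.succ_eq_add_one, hzs]
      exact hp.node_mono h0 hy (Nat.le_succ _) (by omega)
  have hzle : ∀ i ≤ L + 1, x₀ ≤ z i ∧ z i ≤ b := by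
    intro i hi
    rcases Nat.eq_zero_or_pos i with rfl | h
    · rw [hz0]; exact ⟨le_rfl, hx₀b⟩
    · obtain ⟨k, rfl⟩ := Nat.exists_eq_succ_of_ne_zero h.ne'
      rw [Nat.succ_eq_add_one, hzs]
      exact ⟨hp.le_level _ (level_pos h0 hy hi), hp.node_mono h0 hy hi le_rfl⟩
  have hii : ∀ k < L + 1, IntervalIntegrable F volume (z k) (z (k + 1)) := by
    intro k hk
    rw [intervalIntegrable_iff_integrableOn_Ioc_of_le (hzmono k (by omega))]
    exact hi1.mono_set (Set.Ioc_subset_Ioc (hzle k (by omega)).1 (hzle (k + 1) (by omega)).2)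
  have hsplit := intervalIntegral.sum_integral_adjacent_intervals hii
  rw [hz0, hzs, ← hb, Finset.sum_range_succ'] at hsplit
  rw [← intervalIntegral.integral_of_le hx₀b, ← hsplit, add_comm]
  have hbound : ∀ s t C : ℝ, s ≤ t → t ≤ b → (∀ x, s < x → x < t → |p x - Real.exp (g x)| ≤ C) →
      ∫ x in s..t, F x ≤ C * (t - s) := by
    intro s t C hst htb hC
    have h := intervalIntegral.norm_integral_le_of_norm_le_const_ae (a := s) (b := t) (C := C)
      (f := F) (by
        have hne : ∀ᵐ x : ℝ, x ≠ t := by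
          simp [ae_iff, measure_singleton]
        filter_upwards [hne] with x hx hxI
        rw [Set.uIoc_of_le hst] at hxI
        have hxt := lt_of_le_of_ne hxI.2 hx
        rw [hFin x (hxt.trans_le htb), Real.norm_eq_abs, abs_abs]
        exact hC x hxI.1 hxt)
    rw [abs_of_nonneg (sub_nonneg.2 hst)] at h
    exact (le_abs_self _).trans h
  refine add_le_add ?_ ?_
  · rw [hz0, hzs]
    refine (hbound x₀ (β (y 1)) (c * (1 - Real.exp (-y 1))) (hp.le_level _ hpos1)
      (hp.node_mono h0 hy (by omega) le_rfl) fun x h1 h2 => ?_).trans (le_of_eq (by ring))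
    have e1 : Real.exp (g x) = c * Real.exp (-y 1) := by
      rw [hg, hp.affineMin_eq_const h0 hy h1 h2, sub_eq_add_neg, Real.exp_add, Real.exp_log hp.pos]
    rw [e1, abs_of_nonneg (sub_nonneg.2 (hp.le_apply _ hpos1 x h1 h2))]
    linarith [hp.le_top x]
  · rw [Finset.mul_sum]
    refine Finset.sum_le_sum fun i hi => ?_
    have hiL : i < L := Finset.mem_range.1 hi
    rw [hzs, hzs]
    have hyi := level_pos h0 hy (show i ≤ L + 1 by omega)
    have hmono := hp.node_mono h0 hy (Nat.le_succ (i + 1)) (by omega)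
    rcases hmono.lt_or_eq with hlt | heq
    · have hΔ := sub_pos.2 hlt
      set C := c * (Real.exp (-y (i + 1)) * (y (i + 2) - y (i + 1)) ^ 2 *
        (levelSlope β y i - levelSlope β y (i + 1))) with hC
      refine (hbound _ _ (C / (β (y (i + 2)) - β (y (i + 1)))) hmono
        (hp.node_mono h0 hy (by omega) le_rfl) fun x h1 h2 => ?_).trans (le_of_eq ?_)
      · have e1 : Real.exp (g x) = c * Real.exp (chordLine β (y (i + 1)) (y (i + 2)) x) := by
          rw [hg, hp.affineMin_eq_chord h0 hy (by omega) (by omega) h1 h2, Real.exp_add,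
            Real.exp_log hp.pos]
        rw [e1, abs_of_nonneg (sub_nonneg.2 (hp.chordLine_le
          (level_pos h0 hy (by omega)) (hy (i + 1) (by omega)) h1 h2)), le_div_iff₀ hΔ]
        exact hp.sub_chordLine_le hyi (hy i (by omega)) (hy (i + 1) (by omega)) h1 h2
      · exact div_mul_cancel₀ _ hΔ.ne'
    · rw [heq, intervalIntegral.integral_same]
      refine mul_nonneg hp.pos.le (mul_nonneg (by positivity) (sub_nonneg.2 ?_))
      rw [levelSlope, levelSlope, div_le_div_iff₀ (sub_pos.2 (hy (i + 1) (by omega)))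
        (sub_pos.2 (hy i (by omega)))]
      exact hp.concave.three_point hyi (hy i (by omega)) (hy (i + 1) (by omega))

end IsTailProfile

/-! ### Graded levels -/

/-- The levels `-2 log (1 - (i / K) ^ 3)`, `i < K`. The cubic grading makes up for secant slopes as
large as the inverse of the level near level zero; the factor `2` makes the last value `exp (-y)`
of order `K⁻²`. -/
noncomputable def gradedLevel (K i : ℕ) : ℝ := -2 * Real.log (1 - ((i : ℝ) / K) ^ 3)

section GradedLevel

variable {K i : ℕ}

lemma one_sub_cube_pos (hi : i < K) : 0 < 1 - ((i : ℝ) / K) ^ 3 := by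
  have hK : (0 : ℝ) < K := by exact_mod_cast (Nat.zero_le i).trans_lt hi
  have h1 : (i : ℝ) / K < 1 := (div_lt_one hK).2 (by exact_mod_cast hi)
  have h2 : 0 ≤ (i : ℝ) / K := by positivity
  have := pow_lt_one₀ h2 h1 (n := 3) (by norm_num)
  linarith

lemma exp_neg_gradedLevel (hi : i < K) :
    Real.exp (-gradedLevel K i) = (1 - ((i : ℝ) / K) ^ 3) ^ 2 := by
  rw [gradedLevel, show -(-2 * Real.log (1 - ((i : ℝ) / K) ^ 3)) =
    Real.log (1 - ((i : ℝ) / K) ^ 3) + Real.log (1 - ((i : ℝ) / K) ^ 3) by ring, Real.exp_add,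
    Real.exp_log (one_sub_cube_pos hi), sq]

lemma cube_le_gradedLevel (hi : i < K) : ((i : ℝ) / K) ^ 3 ≤ gradedLevel K i := by
  have h := Real.log_le_sub_one_of_pos (one_sub_cube_pos hi)
  have h2 : 0 ≤ ((i : ℝ) / K) ^ 3 := by positivity
  rw [gradedLevel]
  linarith

lemma gradedLevel_lt_succ (hi : i + 1 < K) : gradedLevel K i < gradedLevel K (i + 1) := by
  have hK : (0 : ℝ) < K := by exact_mod_cast (Nat.zero_le _).trans_lt hi
  have h1 : (i : ℝ) / K < ((i + 1 : ℕ) : ℝ) / K := by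
    gcongr
    exact Nat.lt_succ_self i
  have h2 : ((i : ℝ) / K) ^ 3 < (((i + 1 : ℕ) : ℝ) / K) ^ 3 := by gcongr
  have h3 := Real.log_lt_log (one_sub_cube_pos hi)
    (show 1 - (((i + 1 : ℕ) : ℝ) / K) ^ 3 < 1 - ((i : ℝ) / K) ^ 3 by linarith)
  rw [gradedLevel, gradedLevel]
  linarith

/-- The weight of a chord in the total error of the interpolation. -/
lemma exp_neg_gradedLevel_mul_sq_le (hi : i + 2 ≤ K) :
    Real.exp (-gradedLevel K i) * (gradedLevel K (i + 1) - gradedLevel K i) ^ 2 ≤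
      144 * ((i : ℝ) + 1) ^ 4 / (K : ℝ) ^ 6 := by
  have hK : (0 : ℝ) < K := by exact_mod_cast (show 0 < K by omega)
  have hiK : (i : ℝ) + 2 ≤ K := by exact_mod_cast hi
  have hi0 : (0 : ℝ) ≤ i := Nat.cast_nonneg i
  have hs0 := one_sub_cube_pos (show i < K by omega)
  have hs1 := one_sub_cube_pos (show i + 1 < K by omega)
  have hinc := gradedLevel_lt_succ (show i + 1 < K by omega)
  rw [exp_neg_gradedLevel (show i < K by omega)]
  rw [gradedLevel, gradedLevel] at hinc ⊢
  set s := 1 - ((i : ℝ) / K) ^ 3 with hs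
  set t := 1 - (((i + 1 : ℕ) : ℝ) / K) ^ 3 with ht
  have hdiff : s - t ≤ 3 * ((i : ℝ) + 1) ^ 2 / (K : ℝ) ^ 3 := by
    rw [hs, ht, le_div_iff₀ (by positivity)]
    push_cast
    field_simp
    nlinarith
  -- consecutive values of `1 - (i / K) ^ 3` differ at most by the factor `2` up to `i = K - 2`
  have hratio : s ≤ 2 * t := by
    have : 2 * ((i : ℝ) + 1) ^ 3 - i ^ 3 ≤ (K : ℝ) ^ 3 := by
      have : ((i : ℝ) + 2) ^ 3 ≤ (K : ℝ) ^ 3 := by gcongr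
      nlinarith
    rw [hs, ht]
    push_cast
    rw [div_pow, div_pow]
    have hK3 : (0 : ℝ) < (K : ℝ) ^ 3 := by positivity
    have e : (2 * ((i : ℝ) + 1) ^ 3 - i ^ 3) / (K : ℝ) ^ 3 ≤ 1 := (div_le_one hK3).2 this
    rw [sub_div, mul_div_assoc] at e
    linarith
  have hlog : Real.log s - Real.log t ≤ (s - t) / t := by
    rw [← Real.log_div hs0.ne' hs1.ne']
    refine (Real.log_le_sub_one_of_pos (div_pos hs0 hs1)).trans (le_of_eq ?_)
    field_simp
  have hprod : s * (-2 * Real.log t - -2 * Real.log s) ≤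
      12 * ((i : ℝ) + 1) ^ 2 / (K : ℝ) ^ 3 := by
    have hst : 0 ≤ (s - t) / t := by linarith
    calc s * (-2 * Real.log t - -2 * Real.log s) = s * (2 * (Real.log s - Real.log t)) := by ring
      _ ≤ (2 * t) * (2 * ((s - t) / t)) := by
          refine mul_le_mul hratio (by linarith) (by linarith) (by linarith)
      _ = 4 * (s - t) := by field_simp; ring
      _ ≤ 4 * (3 * ((i : ℝ) + 1) ^ 2 / (K : ℝ) ^ 3) := by linarith
      _ = _ := by ring
  have hprod0 : 0 ≤ s * (-2 * Real.log t - -2 * Real.log s) := mul_nonneg hs0.le (by linarith)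
  rw [← mul_pow]
  calc _ ≤ (12 * ((i : ℝ) + 1) ^ 2 / (K : ℝ) ^ 3) ^ 2 := by gcongr
    _ = _ := by
      rw [div_pow]
      ring

end GradedLevel

namespace IsTailProfile

variable {p β : ℝ → ℝ} {c x₀ : ℝ}

/-- A secant slope of `β` beyond the level `u` is at most `(β 1 - x₀) * max 1 u⁻¹`; here `w` is a
lower bound of `min 1 u`. -/
lemma secant_mul_le (hp : IsTailProfile p c x₀ β) {u v w : ℝ} (hw : 0 < w) (hwu : w ≤ u)
    (hw1 : w ≤ 1) (huv : u < v) : (β v - β u) * w ≤ (β 1 - x₀) * (v - u) := by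
  have key : ∀ u v : ℝ, 0 < u → u < v → (β v - β u) * u ≤ (β u - x₀) * (v - u) := by
    intro u v hu huv
    have hv := sub_pos.2 huv
    rcases (hp.mono hu (hu.trans huv) huv.le).lt_or_eq with h | h
    · have h1 := hp.chordLine_nonneg hu huv h le_rfl
      have h2 := chordLine_mul h x₀
      have h3 := sub_pos.2 h
      nlinarith
    · rw [h, sub_self, zero_mul]
      exact mul_nonneg (sub_nonneg.2 (hp.le_level v (hu.trans huv))) hv.le
  have hu : 0 < u := hw.trans_le hwu
  have hΔ : 0 ≤ β v - β u := sub_nonneg.2 (hp.mono hu (hu.trans huv) huv.le)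
  have h1 := key u v hu huv
  have hv := sub_pos.2 huv
  rcases le_or_gt u 1 with hu1 | hu1
  · have h2 : β u ≤ β 1 := hp.mono hu (Set.mem_Ioi.2 one_pos) hu1
    nlinarith
  · have h2 := key 1 u one_pos hu1
    have h3 : (β v - β u) * u ≤ ((β 1 - x₀) * (v - u)) * u := by nlinarith
    have h4 := le_of_mul_le_mul_right h3 hu
    nlinarith

lemma mul_level_one_le (hp : IsTailProfile p c x₀ β) (hint : Integrable p) :
    c * (β 1 - x₀) ≤ Real.exp 1 * ∫ x in Set.Ioi x₀, p x := by
  have h1 : x₀ ≤ β 1 := hp.le_level 1 one_pos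
  have h2 : ∫ x in Set.Ioo x₀ (β 1), c * Real.exp (-1) ≤ ∫ x in Set.Ioo x₀ (β 1), p x :=
    setIntegral_mono_on (integrableOn_const (by simp)) hint.integrableOn measurableSet_Ioo
      fun x hx => hp.le_apply 1 one_pos x hx.1 hx.2
  have h3 : ∫ x in Set.Ioo x₀ (β 1), p x ≤ ∫ x in Set.Ioi x₀, p x :=
    setIntegral_mono_set hint.integrableOn (Filter.Eventually.of_forall hp.nonneg)
      (Set.Ioo_subset_Ioi_self.eventuallyLE)
  rw [setIntegral_const, Real.volume_real_Ioo_of_le h1, smul_eq_mul] at h2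
  have h4 := h2.trans h3
  have h5 : Real.exp 1 * ((β 1 - x₀) * (c * Real.exp (-1))) = c * (β 1 - x₀) := by
    rw [Real.exp_neg]
    field_simp
  rw [← h5]
  exact mul_le_mul_of_nonneg_left h4 (Real.exp_pos 1).le

end IsTailProfile

lemma sum_mul_sub_eq (w m : ℕ → ℝ) (L : ℕ) :
    ∑ i ∈ Finset.range L, w i * (m i - m (i + 1)) =
      w 0 * m 0 - w L * m L + ∑ i ∈ Finset.range L, (w (i + 1) - w i) * m (i + 1) := by
  induction L with
  | zero => simp
  | succ L ih => rw [Finset.sum_range_succ, Finset.sum_range_succ, ih]; ring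

namespace IsTailProfile

variable {p β : ℝ → ℝ} {c x₀ : ℝ}

/-- Interpolation of a tail at the graded levels has an `L¹`-error of order `K⁻²`, relative to the
mass of the tail. -/
theorem integral_abs_sub_graded_le (hp : IsTailProfile p c x₀ β) (hint : Integrable p) {K : ℕ}
    (hK : 200 ≤ K) :
    ∫ x in Set.Ioi x₀, |p x - (Set.Iio (β (gradedLevel K (K - 1)))).indicator
        (fun x => Real.exp (affineMin (Real.log c - gradedLevel K 10)
          (chordSet β c (fun i => gradedLevel K (i + 9)) (K - 11)) x)) x| ≤
      2806 / (K : ℝ) ^ 2 * ∫ x in Set.Ioi x₀, p x := by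
  set y : ℕ → ℝ := fun i => gradedLevel K (i + 9) with hy
  obtain ⟨L, hKL⟩ : ∃ L, K = L + 11 := ⟨K - 11, by omega⟩
  have hx : (200 : ℝ) ≤ K := by exact_mod_cast hK
  have hK0 : (0 : ℝ) < K := by linarith
  have hyinc : ∀ i ≤ L, y i < y (i + 1) := by
    intro i hi
    have := gradedLevel_lt_succ (K := K) (i := i + 9) (by omega)
    simpa only [hy, add_right_comm] using this
  have hycube : ∀ i ≤ L + 1, (((i + 9 : ℕ) : ℝ) / K) ^ 3 ≤ y i := fun i hi =>
    cube_le_gradedLevel (by omega)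
  have hy0 : 0 < y 0 := lt_of_lt_of_le (by positivity) (hycube 0 (by omega))
  have hlast : gradedLevel K (K - 1) = y (L + 1) := by
    simp only [hy]
    congr 1
    omega
  have hfirst : gradedLevel K 10 = y 1 := rfl
  have hL : K - 11 = L := by omega
  rw [hlast, hfirst, hL]
  refine (hp.integral_abs_sub_interpolation_le hint hy0 hyinc).trans ?_
  set V := β 1 - x₀ with hV
  have hV0 : 0 ≤ V := sub_nonneg.2 (hp.le_level 1 one_pos)
  set m := levelSlope β y with hm
  -- `((i + 9) / K) ^ 3` is at most `1` and at most the level `y i`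
  have hmle : ∀ i ≤ L, m i ≤ V * ((K : ℝ) ^ 3 / ((i : ℝ) + 9) ^ 3) := by
    intro i hi
    have hw0 : (0 : ℝ) < (((i + 9 : ℕ) : ℝ) / K) ^ 3 := by positivity
    have hw1 : (((i + 9 : ℕ) : ℝ) / K) ^ 3 ≤ 1 := by
      refine pow_le_one₀ (by positivity) ((div_le_one hK0).2 ?_)
      exact_mod_cast (show i + 9 ≤ K by omega)
    have h := hp.secant_mul_le hw0 (hycube i (by omega)) hw1 (hyinc i hi)
    have hd := sub_pos.2 (hyinc i hi)
    have h2 : m i * (((i + 9 : ℕ) : ℝ) / K) ^ 3 ≤ V := by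
      rw [hm, levelSlope, div_mul_eq_mul_div, div_le_iff₀ hd]
      exact h
    rw [← le_div_iff₀ hw0] at h2
    refine h2.trans (le_of_eq ?_)
    push_cast
    rw [div_pow, div_div_eq_mul_div, mul_div_assoc]
  have hmanti : ∀ i < L, m (i + 1) ≤ m i := by
    intro i hi
    rw [hm, levelSlope, levelSlope, div_le_div_iff₀ (sub_pos.2 (hyinc (i + 1) (by omega)))
      (sub_pos.2 (hyinc i (by omega)))]
    exact hp.concave.three_point (level_pos hy0 hyinc (by omega)) (hyinc i (by omega))
      (hyinc (i + 1) (by omega))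
  have hm0 : 0 ≤ m L := by
    refine div_nonneg (sub_nonneg.2 ?_) (sub_pos.2 (hyinc L le_rfl)).le
    exact hp.node_mono hy0 hyinc (Nat.le_succ L) le_rfl
  -- the part up to the first node
  have hy1 : y 1 ≤ 11 / (K : ℝ) ^ 2 := by
    have hr : (0 : ℝ) < (K : ℝ) ^ 3 - 1000 := by nlinarith [sq_nonneg ((K : ℝ) - 200)]
    have hs : (0 : ℝ) < 1 - ((10 : ℝ) / K) ^ 3 := one_sub_cube_pos (K := K) (i := 10) (by omega)
    have h1 := Real.log_le_sub_one_of_pos (inv_pos.2 hs)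
    rw [Real.log_inv] at h1
    have h2 : (1 - ((10 : ℝ) / K) ^ 3)⁻¹ - 1 = 1000 / ((K : ℝ) ^ 3 - 1000) := by
      have : 1 - ((10 : ℝ) / K) ^ 3 = ((K : ℝ) ^ 3 - 1000) / (K : ℝ) ^ 3 := by
        field_simp
        norm_num
      rw [this, inv_div]
      field_simp
      ring
    have h3 : 1000 / ((K : ℝ) ^ 3 - 1000) ≤ 11 / 2 / (K : ℝ) ^ 2 := by
      rw [div_le_div_iff₀ hr (by positivity)]
      nlinarith
    have h4 : y 1 = -2 * Real.log (1 - ((10 : ℝ) / K) ^ 3) := by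
      simp only [hy, gradedLevel]
      norm_num
    rw [h4]
    have h5 : 11 / (K : ℝ) ^ 2 = 2 * (11 / 2 / (K : ℝ) ^ 2) := by ring
    rw [h5]
    linarith
  have hT1 : (1 - Real.exp (-y 1)) * (β (y 1) - x₀) ≤ 11 / (K : ℝ) ^ 2 * V := by
    have hy1pos := level_pos hy0 hyinc (show 1 ≤ L + 1 by omega)
    have hy1' : y 1 ≤ 1 := by
      refine hy1.trans ((div_le_one (by positivity)).2 ?_)
      nlinarith
    have h1 : β (y 1) ≤ β 1 := hp.mono hy1pos (Set.mem_Ioi.2 one_pos) hy1'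
    have h2 := Real.add_one_le_exp (-y 1)
    refine mul_le_mul (by linarith) (by linarith) (sub_nonneg.2 (hp.le_level _ hy1pos))
      (by positivity)
  -- the chords, by summation by parts
  set w : ℕ → ℝ := fun i => 144 * ((i : ℝ) + 11) ^ 4 / (K : ℝ) ^ 6 with hw
  have hT2 : ∑ i ∈ Finset.range L, Real.exp (-y (i + 1)) * (y (i + 2) - y (i + 1)) ^ 2 *
      (m i - m (i + 1)) ≤ 1011 / (K : ℝ) ^ 2 * V := by
    have h1 : ∑ i ∈ Finset.range L, Real.exp (-y (i + 1)) * (y (i + 2) - y (i + 1)) ^ 2 *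
        (m i - m (i + 1)) ≤ ∑ i ∈ Finset.range L, w i * (m i - m (i + 1)) := by
      refine Finset.sum_le_sum fun i hi => ?_
      have hiL := Finset.mem_range.1 hi
      refine mul_le_mul_of_nonneg_right ?_ (sub_nonneg.2 (hmanti i hiL))
      have := exp_neg_gradedLevel_mul_sq_le (K := K) (i := i + 10) (by omega)
      refine this.trans (le_of_eq ?_)
      rw [hw]
      push_cast
      ring
    rw [sum_mul_sub_eq w m] at h1
    have h2 : w 0 * m 0 ≤ 15 / (K : ℝ) ^ 2 * V := by
      have h3 : w 0 * m 0 ≤ w 0 * (V * ((K : ℝ) ^ 3 / (((0 : ℕ) : ℝ) + 9) ^ 3)) :=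
        mul_le_mul_of_nonneg_left (hmle 0 (Nat.zero_le _)) (by positivity)
      refine h3.trans ?_
      have h4 : w 0 * (V * ((K : ℝ) ^ 3 / (((0 : ℕ) : ℝ) + 9) ^ 3)) =
          (144 * 11 ^ 4 / 9 ^ 3 / (K : ℝ)) * (1 / (K : ℝ) ^ 2) * V := by
        rw [hw]
        push_cast
        field_simp
        ring
      rw [h4]
      have h5 : (144 * 11 ^ 4 / 9 ^ 3 / (K : ℝ)) ≤ 15 := by
        rw [div_le_iff₀ hK0]
        norm_num
        linarith
      calc _ ≤ 15 * (1 / (K : ℝ) ^ 2) * V := by gcongr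
        _ = _ := by ring
    have h3 : ∀ i ∈ Finset.range L, (w (i + 1) - w i) * m (i + 1) ≤ 996 / (K : ℝ) ^ 3 * V := by
      intro i hi
      have hiL := Finset.mem_range.1 hi
      set a : ℝ := (i : ℝ) + 10 with ha
      have ha10 : 10 ≤ a := by
        have : (0 : ℝ) ≤ i := Nat.cast_nonneg i
        linarith
      have e1 : w (i + 1) - w i = 144 * ((a + 2) ^ 4 - (a + 1) ^ 4) / (K : ℝ) ^ 6 := by
        rw [hw, ha]
        push_cast
        ring
      -- `(a + 2) ^ 4 - (a + 1) ^ 4 ≤ 4 (a + 2) ^ 3 ≤ 4 (1.2 a) ^ 3`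
      have e2 : 144 * ((a + 2) ^ 4 - (a + 1) ^ 4) ≤ 996 * a ^ 3 := by
        have q1 : (a + 2) ^ 4 - (a + 1) ^ 4 ≤ 4 * (a + 2) ^ 3 := by nlinarith
        have q2 : (a + 2) ^ 3 ≤ (6 / 5 * a) ^ 3 := by
          refine pow_le_pow_left₀ (by linarith) (by linarith) 3
        have q3 : (0 : ℝ) ≤ a ^ 3 := by positivity
        have q4 : (6 / 5 * a) ^ 3 = 216 / 125 * a ^ 3 := by ring
        rw [q4] at q2
        nlinarith
      have e3 : 0 ≤ w (i + 1) - w i := by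
        rw [e1]
        refine div_nonneg (mul_nonneg (by norm_num) (sub_nonneg.2 ?_)) (by positivity)
        gcongr
        norm_num
      have e4 : m (i + 1) ≤ V * ((K : ℝ) ^ 3 / a ^ 3) := by
        have := hmle (i + 1) (by omega)
        refine this.trans (le_of_eq ?_)
        rw [ha]
        push_cast
        ring
      calc (w (i + 1) - w i) * m (i + 1) ≤ (w (i + 1) - w i) * (V * ((K : ℝ) ^ 3 / a ^ 3)) :=
            mul_le_mul_of_nonneg_left e4 e3
        _ = (144 * ((a + 2) ^ 4 - (a + 1) ^ 4)) * (V / ((K : ℝ) ^ 3 * a ^ 3)) := by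
            rw [e1]
            field_simp
        _ ≤ (996 * a ^ 3) * (V / ((K : ℝ) ^ 3 * a ^ 3)) :=
            mul_le_mul_of_nonneg_right e2 (by positivity)
        _ = _ := by field_simp
    have h4 := Finset.sum_le_sum h3
    rw [Finset.sum_const, Finset.card_range, nsmul_eq_mul] at h4
    have h5 : (L : ℝ) * (996 / (K : ℝ) ^ 3 * V) ≤ 996 / (K : ℝ) ^ 2 * V := by
      have : (L : ℝ) ≤ K := by exact_mod_cast (show L ≤ K by omega)
      calc (L : ℝ) * (996 / (K : ℝ) ^ 3 * V) ≤ K * (996 / (K : ℝ) ^ 3 * V) := by gcongr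
        _ = _ := by field_simp
    have h6 : 0 ≤ w L * m L := mul_nonneg (by positivity) hm0
    have h7 : 1011 / (K : ℝ) ^ 2 * V = 15 / (K : ℝ) ^ 2 * V + 996 / (K : ℝ) ^ 2 * V := by ring
    linarith
  -- the part beyond the last node
  have hT3 : Real.exp (-y (L + 1)) * m L ≤ 10 / (K : ℝ) ^ 2 * V := by
    have hcast : ((L + 1 + 9 : ℕ) : ℝ) = K - 1 := by
      rw [hKL]; push_cast; ring
    have h1 : Real.exp (-y (L + 1)) ≤ 9 / (K : ℝ) ^ 2 := by
      have h := exp_neg_gradedLevel (K := K) (i := L + 1 + 9) (by omega)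
      have h0 := one_sub_cube_pos (K := K) (i := L + 1 + 9) (by omega)
      have : 1 - (((L + 1 + 9 : ℕ) : ℝ) / K) ^ 3 ≤ 3 / K := by
        rw [hcast, le_div_iff₀ hK0]
        field_simp
        nlinarith
      simp only [hy]
      rw [h]
      calc _ ≤ (3 / (K : ℝ)) ^ 2 := by gcongr
        _ = _ := by rw [div_pow]; norm_num
    have h2 : m L ≤ V * (10 / 9) := by
      refine (hmle L le_rfl).trans (mul_le_mul_of_nonneg_left ?_ hV0)
      have : (L : ℝ) + 9 = K - 2 := by rw [hKL]; push_cast; ring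
      rw [this, div_le_iff₀ (by have : (0 : ℝ) < K - 2 := by linarith
                                positivity)]
      nlinarith
    calc _ ≤ 9 / (K : ℝ) ^ 2 * (V * (10 / 9)) := mul_le_mul h1 h2 hm0 (by positivity)
      _ = _ := by ring
  have hmass := hp.mul_level_one_le hint
  have htot : c * ((1 - Real.exp (-y 1)) * (β (y 1) - x₀)) +
      c * ∑ i ∈ Finset.range L, Real.exp (-y (i + 1)) * (y (i + 2) - y (i + 1)) ^ 2 *
        (m i - m (i + 1)) + c * (Real.exp (-y (L + 1)) * m L) ≤ 1032 / (K : ℝ) ^ 2 * (c * V) := by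
    have h1 := mul_le_mul_of_nonneg_left (add_le_add (add_le_add hT1 hT2) hT3) hp.pos.le
    refine le_trans (le_of_eq (by ring)) (h1.trans (le_of_eq (by ring)))
  refine htot.trans ?_
  have hI : 0 ≤ ∫ x in Set.Ioi x₀, p x := integral_nonneg hp.nonneg
  have he := Real.exp_one_lt_d9
  calc 1032 / (K : ℝ) ^ 2 * (c * V)
      ≤ 1032 / (K : ℝ) ^ 2 * (2806 / 1032 * ∫ x in Set.Ioi x₀, p x) := by
        refine mul_le_mul_of_nonneg_left (hmass.trans ?_) (by positivity)
        refine mul_le_mul_of_nonneg_right (he.le.trans (by norm_num)) hI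
    _ = _ := by ring

end IsTailProfile

/-! ### Level functions of log-concave densities -/

/-- Log-concavity on the level of strict lower bounds, with no reference to the support. -/
def LogConcaveLevels (p : ℝ → ℝ) : Prop :=
  ∀ ⦃x₁ x₂ a b s t : ℝ⦄, 0 ≤ s → 0 ≤ t → s + t = 1 → Real.exp a < p x₁ → Real.exp b < p x₂ →
    Real.exp (s * a + t * b) < p (s * x₁ + t * x₂)

lemma logConcaveLevels_of_mem {p : ℝ → ℝ} (hp : p ∈ logConcaveDensities) :
    LogConcaveLevels p := by
  intro x₁ x₂ a b s t hs ht hst h1 h2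
  obtain ⟨-, -, -, -, hc⟩ := hp
  have p1 : 0 < p x₁ := (Real.exp_pos _).trans h1
  have p2 : 0 < p x₂ := (Real.exp_pos _).trans h2
  have h := hc.2 p1 p2 hs ht hst
  have hpos : 0 < p (s * x₁ + t * x₂) := hc.1 p1 p2 hs ht hst
  simp only [smul_eq_mul] at h
  rw [← Real.lt_log_iff_exp_lt hpos]
  have l1 := (Real.lt_log_iff_exp_lt p1).2 h1
  have l2 := (Real.lt_log_iff_exp_lt p2).2 h2
  refine lt_of_lt_of_le ?_ h
  rcases hs.lt_or_eq with hs | rfl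
  · exact add_lt_add_of_lt_of_le (mul_lt_mul_of_pos_left l1 hs)
      (mul_le_mul_of_nonneg_left l2.le ht)
  · have : t = 1 := by linarith
    subst this
    linarith

lemma LogConcaveLevels.comp_neg {p : ℝ → ℝ} (hp : LogConcaveLevels p) :
    LogConcaveLevels fun x => p (-x) := by
  intro x₁ x₂ a b s t hs ht hst h1 h2
  have := hp hs ht hst h1 h2
  rwa [show s * -x₁ + t * -x₂ = -(s * x₁ + t * x₂) by ring] at this

lemma LogConcaveLevels.lt_of_mem_Icc {p : ℝ → ℝ} (hp : LogConcaveLevels p) {a x₁ x₂ x : ℝ}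
    (h1 : Real.exp a < p x₁) (h2 : Real.exp a < p x₂) (hx : x ∈ Set.Icc x₁ x₂) :
    Real.exp a < p x := by
  rw [← segment_eq_Icc (hx.1.trans hx.2)] at hx
  obtain ⟨s, t, hs, ht, hst, rfl⟩ := hx
  have := hp hs ht hst h1 h2
  rwa [← add_mul, hst, one_mul] at this

lemma IsDensity.comp_neg {p : ℝ → ℝ} (hp : IsDensity p) : IsDensity fun x => p (-x) :=
  ⟨fun x => hp.1 _, hp.2.1.comp_neg, by rw [integral_neg_eq_self p volume, hp.2.2]⟩

lemma IsDensity.mul_length_le_one {p : ℝ → ℝ} (hp : IsDensity p) {C u v : ℝ} (huv : u ≤ v)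
    (h : ∀ x ∈ Set.Icc u v, C ≤ p x) : C * (v - u) ≤ 1 := by
  have h1 : ∫ _x in Set.Icc u v, C ≤ ∫ x in Set.Icc u v, p x :=
    setIntegral_mono_on (integrableOn_const (by simp)) hp.2.1.integrableOn measurableSet_Icc h
  have h2 := setIntegral_le_integral hp.2.1 (s := Set.Icc u v)
    (Filter.Eventually.of_forall hp.1)
  rw [setIntegral_const, Real.volume_real_Icc_of_le huv, smul_eq_mul] at h1
  rw [hp.2.2] at h2
  linarith

/-- A log-concave density is bounded: every point keeps a fixed distance from one of the two ends of
an interval in the support, and by log-concavity a large value at the point forces a large mass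
between it and that end. -/
lemma exists_forall_le_of_mem_logConcaveDensities {p : ℝ → ℝ} (hp : p ∈ logConcaveDensities) :
    ∃ C, ∀ x, p x ≤ C := by
  have hl := logConcaveLevels_of_mem hp
  have hd := hp.1
  obtain ⟨x₁, hx₁⟩ : ∃ x, 0 < p x := by
    by_contra hcon
    push Not at hcon
    have : p = 0 := funext fun x => le_antisymm (hcon x) (hd.1 x)
    have h1 := hd.2.2
    simp [this] at h1
  obtain ⟨e, he, hball⟩ := Metric.isOpen_iff.1 hp.2.1 x₁ hx₁
  set δ := e / 2 with hδ
  have hδ0 : 0 < δ := by positivity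
  have hr : 0 < p (x₁ + δ) := hball (by simp [hδ, abs_of_pos he, he])
  have hl' : 0 < p (x₁ - δ) := hball (by simp [hδ, abs_of_pos he, he])
  obtain ⟨h, hh1, hh2⟩ : ∃ h, Real.exp h < p (x₁ + δ) ∧ Real.exp h < p (x₁ - δ) := by
    refine ⟨Real.log (min (p (x₁ + δ)) (p (x₁ - δ)) / 2), ?_⟩
    have hm : 0 < min (p (x₁ + δ)) (p (x₁ - δ)) := lt_min hr hl'
    rw [Real.exp_log (by linarith)]
    exact ⟨(half_lt_self hm).trans_le (min_le_left _ _),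
      (half_lt_self hm).trans_le (min_le_right _ _)⟩
  have key : ∀ x a, Real.exp a < p x → a ≤ max h (2 * Real.log (2 / δ) - h) := by
    intro x a ha
    rcases le_or_gt a h with hah | hah
    · exact le_max_of_le_left hah
    refine le_max_of_le_right ?_
    obtain ⟨z, hz, hxz⟩ : ∃ z, Real.exp h < p z ∧ δ ≤ |x - z| := by
      rcases le_total x x₁ with hx | hx
      · exact ⟨x₁ + δ, hh1, by rw [abs_of_nonpos (by linarith)]; linarith⟩
      · exact ⟨x₁ - δ, hh2, by rw [abs_of_nonneg (by linarith)]; linarith⟩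
    have hmid := hl (show (0 : ℝ) ≤ 1 / 2 by norm_num) (show (0 : ℝ) ≤ 1 / 2 by norm_num)
      (by norm_num) ha hz
    set w := 1 / 2 * x + 1 / 2 * z with hw
    have hx' : Real.exp (1 / 2 * a + 1 / 2 * h) < p x :=
      (Real.exp_lt_exp.2 (by linarith)).trans ha
    have hlen : Real.exp (1 / 2 * a + 1 / 2 * h) * (δ / 2) ≤ 1 := by
      rcases le_total x z with hxz' | hxz'
      · rw [abs_of_nonpos (by linarith)] at hxz
        have := hd.mul_length_le_one (show x ≤ w by linarith)
          fun u hu => (hl.lt_of_mem_Icc hx' hmid hu).le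
        refine le_trans (mul_le_mul_of_nonneg_left ?_ (Real.exp_pos _).le) this
        linarith
      · rw [abs_of_nonneg (by linarith)] at hxz
        have := hd.mul_length_le_one (show w ≤ x by linarith)
          fun u hu => (hl.lt_of_mem_Icc hmid hx' hu).le
        refine le_trans (mul_le_mul_of_nonneg_left ?_ (Real.exp_pos _).le) this
        linarith
    have h1 : Real.exp (1 / 2 * a + 1 / 2 * h) ≤ 2 / δ := by
      rw [le_div_iff₀ hδ0]; linarith
    have h2 := (Real.le_log_iff_exp_le (by positivity)).2 h1
    linarith
  refine ⟨Real.exp (max h (2 * Real.log (2 / δ) - h)), fun x => ?_⟩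
  by_contra hcon
  have hpx : 0 < p x := (Real.exp_pos _).trans (not_le.1 hcon)
  obtain ⟨a, ha1, ha2⟩ := exists_between ((Real.lt_log_iff_exp_lt hpx).2 (not_le.1 hcon))
  exact absurd (key x a ((Real.lt_log_iff_exp_lt hpx).1 ha2)) (not_le.2 ha1)

lemma mul_exp_neg_eq {c : ℝ} (hc : 0 < c) (y : ℝ) :
    c * Real.exp (-y) = Real.exp (Real.log c - y) := by
  rw [sub_eq_add_neg, Real.exp_add, Real.exp_log hc]

lemma abs_sub_le_of_lt_of_lt {p : ℝ → ℝ} (hl : LogConcaveLevels p) (hd : IsDensity p) {c y : ℝ}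
    (hc : 0 < c) {s t : ℝ} (hs : c * Real.exp (-y) < p s) (ht : c * Real.exp (-y) < p t) :
    |s - t| ≤ (c * Real.exp (-y))⁻¹ := by
  wlog hst : s ≤ t generalizing s t
  · rw [abs_sub_comm]
    exact this ht hs (le_of_not_ge hst)
  rw [mul_exp_neg_eq hc] at hs ht ⊢
  have := hd.mul_length_le_one hst fun u hu => (hl.lt_of_mem_Icc hs ht hu).le
  rw [abs_sub_comm, abs_of_nonneg (sub_nonneg.2 hst), ← one_div, le_div_iff₀ (Real.exp_pos _)]
  linarith

/-- The right tail of a density with log-concave levels, seen from a point `x₀` that lies between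
the end points of all superlevel sets. -/
lemma isTailProfile_sSup {p : ℝ → ℝ} (hl : LogConcaveLevels p) (hd : IsDensity p) {c x₀ : ℝ}
    (hc : 0 < c) (hle : ∀ x, p x ≤ c)
    (h1 : ∀ y, 0 < y → ∀ x, x₀ < x → ∃ s < x, c * Real.exp (-y) < p s)
    (h2 : ∀ y, 0 < y → ∀ x, x < x₀ → ∃ s > x, c * Real.exp (-y) < p s) :
    IsTailProfile p c x₀ fun y => sSup {x | c * Real.exp (-y) < p x} := by
  have hne : ∀ y, 0 < y → {x | c * Real.exp (-y) < p x}.Nonempty := fun y hy => by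
    obtain ⟨s, -, hs⟩ := h1 y hy (x₀ + 1) (by linarith)
    exact ⟨s, hs⟩
  have hbdd : ∀ y, 0 < y → BddAbove {x | c * Real.exp (-y) < p x} := by
    intro y hy
    obtain ⟨s, hs⟩ := hne y hy
    refine ⟨s + (c * Real.exp (-y))⁻¹, fun t ht => ?_⟩
    have := (le_abs_self _).trans (abs_sub_le_of_lt_of_lt hl hd hc ht hs)
    linarith
  refine ⟨hc, hd.1, hle, ⟨convex_Ioi 0, ?_⟩, ?_, ?_, ?_, ?_⟩
  · intro y₁ hy₁ y₂ hy₂ s t hs ht hst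
    have hy : 0 < s • y₁ + t • y₂ := (convex_Ioi (0 : ℝ)) hy₁ hy₂ hs ht hst
    simp only [smul_eq_mul] at hy ⊢
    -- it suffices to approximate both suprema by points of the superlevel sets
    refine le_of_forall_pos_le_add fun e he => ?_
    obtain ⟨u₁, hu₁, hlt₁⟩ := exists_lt_of_lt_csSup (hne y₁ hy₁) (sub_lt_self _ he)
    obtain ⟨u₂, hu₂, hlt₂⟩ := exists_lt_of_lt_csSup (hne y₂ hy₂) (sub_lt_self _ he)
    have hmem : c * Real.exp (-(s * y₁ + t * y₂)) < p (s * u₁ + t * u₂) := by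
      simp only [Set.mem_ofPred_eq, mul_exp_neg_eq hc] at hu₁ hu₂ ⊢
      have := hl hs ht hst hu₁ hu₂
      rwa [show s * (Real.log c - y₁) + t * (Real.log c - y₂) =
        Real.log c - (s * y₁ + t * y₂) by linear_combination Real.log c * hst] at this
    have h3 := le_csSup (hbdd _ hy) hmem
    have h4 := mul_le_mul_of_nonneg_left hlt₁.le hs
    have h5 := mul_le_mul_of_nonneg_left hlt₂.le ht
    have h6 : s * e + t * e = e := by rw [← add_mul, hst, one_mul]
    linarith
  · intro y₁ hy₁ y₂ hy₂ hy
    refine csSup_le_csSup (hbdd y₂ hy₂) (hne y₁ hy₁) fun x hx => ?_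
    refine lt_of_le_of_lt ?_ (show c * Real.exp (-y₁) < p x from hx)
    exact mul_le_mul_of_nonneg_left (Real.exp_le_exp.2 (neg_le_neg hy)) hc.le
  · intro y hy
    by_contra hcon
    obtain ⟨s, hs, hps⟩ := h2 y hy _ (not_le.1 hcon)
    exact absurd (le_csSup (hbdd y hy) hps) (not_le.2 hs)
  · intro y hy x hx₀ hx
    obtain ⟨s, hs, hps⟩ := h1 y hy x hx₀
    obtain ⟨t, ht, hxt⟩ := exists_lt_of_lt_csSup (hne y hy) hx
    rw [Set.mem_ofPred_eq, mul_exp_neg_eq hc] at ht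
    rw [mul_exp_neg_eq hc] at hps ⊢
    exact (hl.lt_of_mem_Icc hps ht ⟨hs.le, hxt.le⟩).le
  · intro y hy x hx
    by_contra hcon
    exact absurd (le_csSup (hbdd y hy) (not_le.1 hcon)) (not_le.2 hx)

/-- A log-concave density seen from a mode: the description of both tails. -/
lemma exists_isTailProfile {p : ℝ → ℝ} (hp : p ∈ logConcaveDensities) :
    ∃ (c x₀ : ℝ) (β γ : ℝ → ℝ), IsTailProfile p c x₀ β ∧
      IsTailProfile (fun x => p (-x)) c (-x₀) γ := by
  have hl := logConcaveLevels_of_mem hp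
  have hd := hp.1
  obtain ⟨C, hC⟩ := exists_forall_le_of_mem_logConcaveDensities hp
  have hbdd : BddAbove (Set.range p) := ⟨C, by rintro _ ⟨x, rfl⟩; exact hC x⟩
  set c := ⨆ x, p x with hcdef
  have hle : ∀ x, p x ≤ c := fun x => le_ciSup hbdd x
  have hc : 0 < c := by
    by_contra hcon
    have : p = 0 := funext fun x => le_antisymm ((hle x).trans (not_lt.1 hcon)) (hd.1 x)
    have h1 := hd.2.2
    simp [this] at h1
  have hne : ∀ y, 0 < y → ∃ s, c * Real.exp (-y) < p s := fun y hy => by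
    refine exists_lt_of_lt_ciSup ?_
    exact mul_lt_of_lt_one_right hc (Real.exp_lt_one_iff.2 (by linarith))
  have hmono : ∀ y y' : ℝ, y ≤ y' → c * Real.exp (-y') ≤ c * Real.exp (-y) := fun y y' h =>
    mul_le_mul_of_nonneg_left (Real.exp_le_exp.2 (neg_le_neg h)) hc.le
  -- the mode is the supremum of the left end points of the superlevel sets
  set T := {t | ∃ y, 0 < y ∧ ∀ s, c * Real.exp (-y) < p s → t ≤ s} with hT
  obtain ⟨s₁, hs₁⟩ := hne 1 one_pos
  have hTne : T.Nonempty := by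
    refine ⟨s₁ - (c * Real.exp (-1))⁻¹, 1, one_pos, fun s hs => ?_⟩
    have := (le_abs_self _).trans (abs_sub_le_of_lt_of_lt hl hd hc hs₁ hs)
    linarith
  have hTb : BddAbove T := by
    refine ⟨s₁ + (c * Real.exp (-1))⁻¹, ?_⟩
    rintro t ⟨y, hy, ht⟩
    obtain ⟨s, hs⟩ := hne (min y 1) (lt_min hy one_pos)
    have h1 := ht s ((hmono _ _ (min_le_left _ _)).trans_lt hs)
    have h2 := (le_abs_self _).trans (abs_sub_le_of_lt_of_lt hl hd hc
      ((hmono _ _ (min_le_right _ _)).trans_lt hs) hs₁)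
    linarith
  have h1 : ∀ y, 0 < y → ∀ x, sSup T < x → ∃ s < x, c * Real.exp (-y) < p s := by
    intro y hy x hx
    by_contra hcon
    push Not at hcon
    refine absurd (le_csSup hTb (show x ∈ T from ⟨y, hy, fun s hs => ?_⟩)) (not_le.2 hx)
    by_contra hsx
    exact absurd hs (not_lt.2 (hcon s (not_le.1 hsx)))
  have h2 : ∀ y, 0 < y → ∀ x, x < sSup T → ∃ s > x, c * Real.exp (-y) < p s := by
    intro y hy x hx
    obtain ⟨t, ⟨y', hy', ht⟩, hxt⟩ := exists_lt_of_lt_csSup hTne hx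
    obtain ⟨s, hs⟩ := hne (min y y') (lt_min hy hy')
    exact ⟨s, hxt.trans_le (ht s ((hmono _ _ (min_le_right _ _)).trans_lt hs)),
      (hmono _ _ (min_le_left _ _)).trans_lt hs⟩
  refine ⟨c, sSup T, _, _, isTailProfile_sSup hl hd hc hle h1 h2,
    isTailProfile_sSup hl.comp_neg hd.comp_neg hc (fun x => hle (-x)) ?_ ?_⟩
  · intro y hy x hx
    obtain ⟨s, hs, hps⟩ := h2 y hy (-x) (by linarith)
    exact ⟨-s, by linarith, by rwa [neg_neg]⟩
  · intro y hy x hx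
    obtain ⟨s, hs, hps⟩ := h1 y hy (-x) (by linarith)
    exact ⟨-s, by linarith, by rwa [neg_neg]⟩

/-! ### Approximation of log-concave densities by piecewise log-affine ones -/

/-- The reflection `x ↦ -x` applied to a set of affine functions. -/
noncomputable def reflectAffine (S : Finset (ℝ × ℝ)) : Finset (ℝ × ℝ) :=
  S.image fun q => (-q.1, q.2)

/-- Affine functions above the constant do not contribute to the minimum. -/
lemma affineMin_union_eq_left {k x : ℝ} {S T : Finset (ℝ × ℝ)}
    (hT : ∀ q ∈ T, k ≤ q.1 * x + q.2) : affineMin k (S ∪ T) x = affineMin k S x := by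
  refine le_antisymm (le_affineMin.2 ⟨affineMin_le_const _ _ _, fun q hq =>
    affineMin_le (Finset.mem_union_left _ hq) x⟩)
    (le_affineMin.2 ⟨affineMin_le_const _ _ _, fun q hq => ?_⟩)
  rcases Finset.mem_union.1 hq with h | h
  · exact affineMin_le h x
  · exact (affineMin_le_const _ _ _).trans (hT q h)

lemma affineMin_reflectAffine (k : ℝ) (S : Finset (ℝ × ℝ)) (x : ℝ) :
    affineMin k (reflectAffine S) x = affineMin k S (-x) := by
  refine le_antisymm (le_affineMin.2 ⟨affineMin_le_const _ _ _, fun q hq => ?_⟩)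
    (le_affineMin.2 ⟨affineMin_le_const _ _ _, fun q hq => ?_⟩)
  · have := affineMin_le (k := k) (Finset.mem_image_of_mem (fun q : ℝ × ℝ => (-q.1, q.2)) hq) x
    simp only at this
    rw [reflectAffine]
    linarith
  · obtain ⟨q', hq', rfl⟩ := Finset.mem_image.1 hq
    have := affineMin_le (k := k) hq' (-x)
    simp only
    linarith

/-- Every log-concave density is within `5612 / K ^ 2` of a piecewise log-affine one with at most
`2 K` break points. -/
theorem exists_piecewiseLogAffine_approx {p : ℝ → ℝ} (hp : p ∈ logConcaveDensities) {K : ℕ}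
    (hK : 200 ≤ K) :
    ∃ r ∈ piecewiseLogAffineDensities (2 * K), l1Norm (p - r) ≤ 5612 / (K : ℝ) ^ 2 := by
  have hd := hp.1
  have hint := hd.2.1
  obtain ⟨c, x₀, β, γ, hβ, hγ⟩ := exists_isTailProfile hp
  have hR := hβ.integral_abs_sub_graded_le hint hK
  have hL := hγ.integral_abs_sub_graded_le hint.comp_neg hK
  set y : ℕ → ℝ := fun i => gradedLevel K (i + 9) with hy
  set k := Real.log c - gradedLevel K 10 with hk
  set S := chordSet β c y (K - 11) with hS
  set S' := chordSet γ c y (K - 11) with hS'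
  set b := β (gradedLevel K (K - 1)) with hb
  set b' := γ (gradedLevel K (K - 1)) with hb'
  have h10 : 0 ≤ gradedLevel K 10 :=
    le_trans (by positivity) (cube_le_gradedLevel (K := K) (i := 10) (by omega))
  have hkc : k ≤ Real.log c := by linarith
  have hlast : 0 < gradedLevel K (K - 1) := by
    refine lt_of_lt_of_le ?_ (cube_le_gradedLevel (K := K) (i := K - 1) (by omega))
    have h1 : (0 : ℝ) < ((K - 1 : ℕ) : ℝ) := by exact_mod_cast (show 0 < K - 1 by omega)
    have h2 : (0 : ℝ) < K := by exact_mod_cast (show 0 < K by omega)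
    positivity
  have hx₀b : x₀ ≤ b := hβ.le_level _ hlast
  have hx₀b' : -x₀ ≤ b' := hγ.le_level _ hlast
  have hy0 : 0 < y 0 := by
    refine lt_of_lt_of_le ?_ (cube_le_gradedLevel (K := K) (i := 0 + 9) (by omega))
    have h2 : (0 : ℝ) < K := by exact_mod_cast (show 0 < K by omega)
    positivity
  have hyinc : ∀ i ≤ K - 11, y i < y (i + 1) := by
    intro i hi
    have := gradedLevel_lt_succ (K := K) (i := i + 9) (by omega)
    simpa only [hy, add_right_comm] using this
  set g := affineMin k (S ∪ reflectAffine S') with hg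
  set f : ℝ → ℝ := (Set.Ioo (-b') b).indicator fun x => Real.exp (g x) with hf
  -- the minimum restricts to the interpolation of the respective tail on each side of the mode
  have hfR : ∀ x, x₀ < x → f x = (Set.Iio b).indicator (fun x => Real.exp (affineMin k S x)) x := by
    intro x hx
    have e : g x = affineMin k S x := by
      refine affineMin_union_eq_left fun q hq => ?_
      obtain ⟨q', hq', rfl⟩ := Finset.mem_image.1 hq
      have := hγ.log_le_of_mem_chordSet hy0 hyinc hq' (x := -x) (by linarith)
      simp only
      linarith
    by_cases hxb : x < b
    · rw [hf, Set.indicator_of_mem (show x ∈ Set.Ioo (-b') b from ⟨by linarith, hxb⟩),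
        Set.indicator_of_mem (show x ∈ Set.Iio b from hxb), e]
    · rw [hf, Set.indicator_of_notMem (fun h => hxb h.2), 
        Set.indicator_of_notMem (show x ∉ Set.Iio _ from hxb)]
  have hfL : ∀ x, -x₀ < x →
      f (-x) = (Set.Iio b').indicator (fun x => Real.exp (affineMin k S' x)) x := by
    intro x hx
    have e : g (-x) = affineMin k S' x := by
      rw [hg, Finset.union_comm, affineMin_union_eq_left, affineMin_reflectAffine, neg_neg]
      intro q hq
      have := hβ.log_le_of_mem_chordSet hy0 hyinc hq (x := -x) (by linarith)
      linarith
    by_cases hxb : x < b'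
    · rw [hf, Set.indicator_of_mem (show -x ∈ Set.Ioo (-b') b from ⟨by linarith, by linarith⟩),
        Set.indicator_of_mem (show x ∈ Set.Iio b' from hxb), e]
    · rw [hf, Set.indicator_of_notMem (fun h => hxb (neg_lt_neg_iff.1 h.1)),
        
        Set.indicator_of_notMem (show x ∉ Set.Iio _ from hxb)]
  have hfint : Integrable f := by
    refine IntegrableOn.integrable_indicator ?_ measurableSet_Ioo
    exact ((Real.continuous_exp.comp (continuous_affineMin _ _)).integrableOn_Icc
      (a := -b') (b := b)).mono_set Set.Ioo_subset_Icc_self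
  have hG : Integrable fun x => |p x - f x| := (hint.sub hfint).abs
  have herr : ∫ x, |p x - f x| ≤ 2806 / (K : ℝ) ^ 2 := by
    have hsplit := integral_add_compl (measurableSet_Ioi (a := x₀)) hG
    have hsplitp := integral_add_compl (measurableSet_Ioi (a := x₀)) hint
    rw [Set.compl_Ioi] at hsplit hsplitp
    have e1 : ∫ x in Set.Ioi x₀, |p x - f x| ≤ 2806 / (K : ℝ) ^ 2 * ∫ x in Set.Ioi x₀, p x := by
      refine le_trans (le_of_eq ?_) hR
      exact setIntegral_congr_fun measurableSet_Ioi fun x hx => by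
        rw [hfR x hx]
    have e2 : ∫ x in Set.Iic x₀, |p x - f x| ≤ 2806 / (K : ℝ) ^ 2 * ∫ x in Set.Iic x₀, p x := by
      have q1 := integral_comp_neg_Iic x₀ fun x => |p (-x) - f (-x)|
      have q2 := integral_comp_neg_Iic x₀ fun x => p (-x)
      simp only [neg_neg] at q1 q2
      rw [q1, q2]
      refine le_trans (le_of_eq ?_) hL
      exact setIntegral_congr_fun measurableSet_Ioi fun x hx => by
        rw [hfL x hx]
    rw [← hsplit]
    refine (add_le_add e1 e2).trans (le_of_eq ?_)
    rw [← mul_add, hsplitp, hd.2.2, mul_one]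
  -- normalization
  set I := ∫ x, f x with hI
  have hI1 : |1 - I| ≤ ∫ x, |p x - f x| := by
    rw [hI, ← hd.2.2, ← integral_sub hint hfint]
    exact abs_integral_le_integral_abs
  have hK' : (200 : ℝ) ≤ K := by exact_mod_cast hK
  have hsmall : 2806 / (K : ℝ) ^ 2 < 1 := by
    rw [div_lt_one (by positivity)]
    nlinarith
  have hIpos : 0 < I := by
    have := (abs_le.1 (hI1.trans herr)).2
    linarith
  obtain ⟨hr1, A, hA1, hA2, hA3⟩ := affineMin_mem_piecewiseLogAffineDensities (k := k)
    (a := -b') (b := b) (S ∪ reflectAffine S') hIpos hfint rfl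
  refine ⟨fun x => f x / I, ⟨hr1, A, hA1, hA2.trans ?_, hA3⟩, ?_⟩
  · have h1 := Finset.card_union_le S (reflectAffine S')
    have h2 : (reflectAffine S').card ≤ S'.card := Finset.card_image_le
    have h3 := card_chordSet_le β c y (K - 11)
    have h4 := card_chordSet_le γ c y (K - 11)
    rw [← hS] at h3
    rw [← hS'] at h4
    omega
  · have h1 : ∀ x, |p x - f x / I| ≤ |p x - f x| + f x * (|1 - I| / I) := by
      intro x
      have hfx : 0 ≤ f x := Set.indicator_nonneg (fun _ _ => (Real.exp_pos _).le) x
      have h2 : |f x - f x / I| = f x * (|1 - I| / I) := by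
        rw [show f x - f x / I = -(f x * ((1 - I) / I)) by field_simp; ring, abs_neg, abs_mul,
          abs_of_nonneg hfx, abs_div, abs_of_pos hIpos]
      rw [← h2]
      exact abs_sub_le _ _ _
    have h2 : l1Norm (p - fun x => f x / I) ≤ ∫ x, (|p x - f x| + f x * (|1 - I| / I)) :=
      integral_mono (hint.sub (hfint.div_const I)).abs (hG.add (hfint.mul_const _)) h1
    rw [integral_add hG (hfint.mul_const _), integral_mul_const, ← hI, mul_div_cancel₀ _ hIpos.ne']
      at h2
    have h3 : 5612 / (K : ℝ) ^ 2 = 2806 / (K : ℝ) ^ 2 + 2806 / (K : ℝ) ^ 2 := by ring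
    linarith

/-! ### Choice of the number of pieces -/

/-- The rate `n ^ (-2/5)` balances the approximation error `K⁻²` against the stochastic error
`√(K / n)` at `K ≈ 20 n ^ (1/5)`. -/
lemma exists_oracle_bound {M : Set (ℝ → ℝ)} (hM : IsLogConcaveModel M) {p : ℝ → ℝ}
    (hp : p ∈ logConcaveDensities) {n : ℕ} (hn : 100000 ≤ n) :
    ∃ D, ∃ r ∈ M, r ∈ piecewiseLogAffineDensities D ∧
      3 * l1Norm (p - r) + 32 * √((D + 1 : ℝ) / n) ≤ 300 / (n : ℝ) ^ (2 / 5 : ℝ) := by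
  obtain ⟨-, O, hO, hOM⟩ := hM
  have hn' : (100000 : ℝ) ≤ n := by exact_mod_cast hn
  have hn0 : (0 : ℝ) < n := by linarith
  set a : ℝ := (n : ℝ) ^ (1 / 5 : ℝ) with ha
  have ha0 : 0 < a := Real.rpow_pos_of_pos hn0 _
  have ha5 : a ^ 5 = n := by
    rw [ha, ← Real.rpow_natCast, ← Real.rpow_mul hn0.le]
    norm_num
  have ha2 : (n : ℝ) ^ (2 / 5 : ℝ) = a ^ 2 := by
    rw [ha, ← Real.rpow_natCast, ← Real.rpow_mul hn0.le]
    norm_num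
  have ha10 : 10 ≤ a := by
    by_contra hcon
    have : a ^ 5 < 10 ^ 5 := by
      have := not_le.1 hcon
      gcongr
    rw [ha5] at this
    linarith
  set K := ⌈20 * a⌉₊ with hK
  have hK1 : 20 * a ≤ K := Nat.le_ceil _
  have hK2 : (K : ℝ) < 20 * a + 1 := Nat.ceil_lt_add_one (by positivity)
  have hK200 : 200 ≤ K := by
    have : (200 : ℝ) ≤ K := by linarith
    exact_mod_cast this
  obtain ⟨r₀, hr₀, happ⟩ := exists_piecewiseLogAffine_approx hp hK200
  obtain ⟨-, hOsub, hOdense⟩ := hO (2 * K) (by omega)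
  obtain ⟨r, hr, hrr⟩ := hOdense r₀ hr₀ (1 / a ^ 2) (by positivity)
  refine ⟨2 * K, r, hOM (2 * K) (by omega) hr, hOsub hr, ?_⟩
  have htri := l1Norm_sub_le hp.1.2.1 hr₀.1.1.2.1 (hOsub hr).1.1.2.1
  have h1 : 5612 / (K : ℝ) ^ 2 ≤ 5612 / 400 / a ^ 2 := by
    rw [div_div]
    have : 400 * a ^ 2 ≤ (K : ℝ) ^ 2 := by nlinarith
    gcongr
  have h2 : √(((2 * K : ℕ) + 1 : ℝ) / n) ≤ 7 / a ^ 2 := by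
    refine Real.sqrt_le_iff.2 ⟨by positivity, ?_⟩
    rw [← ha5, div_pow, div_le_div_iff₀ (by positivity) (by positivity)]
    push_cast
    have : 2 * (K : ℝ) + 1 ≤ 49 * a := by linarith
    calc (2 * (K : ℝ) + 1) * (a ^ 2) ^ 2 ≤ (49 * a) * (a ^ 2) ^ 2 := by gcongr
      _ = 7 ^ 2 * a ^ 5 := by ring
  rw [ha2]
  have h3 : 3 * (5612 / 400 / a ^ 2 + 1 / a ^ 2) + 32 * (7 / a ^ 2) ≤ 300 / a ^ 2 := by
    rw [show 3 * (5612 / 400 / a ^ 2 + 1 / a ^ 2) + 32 * (7 / a ^ 2) =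
      (3 * (5612 / 400 + 1) + 224) / a ^ 2 by ring]
    gcongr
    norm_num
  linarith

theorem mainTheorem2 {Ω : Type*} [MeasurableSpace Ω] (P : Measure Ω) [IsProbabilityMeasure P]
    (n : ℕ) (hn : 1 ≤ n) (p : ℝ → ℝ) (hp : p ∈ logConcaveDensities)
    (X : Fin n → Ω → ℝ) (hX : ∀ i, HasLaw (X i) (densityMeasure p) P) (hindep : iIndepFun X P)
    (M : Set (ℝ → ℝ)) (hM : IsLogConcaveModel M) (ε : ℝ) (hε : 0 < ε)
    (phat : (Fin n → ℝ) → (ℝ → ℝ)) (hphat : IsTVEstimator M ε phat) :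
    Integrable (fun ω => l1Norm (p - phat (fun i => X i ω))) P ∧
      ∫ ω, l1Norm (p - phat (fun i => X i ω)) ∂P ≤
        300 / (n : ℝ) ^ (2 / 5 : ℝ) + 837 / Real.sqrt n + 2 * ε / n := by
  have hMsub : M ⊆ logConcaveDensities := hM.1.2.1
  obtain ⟨hint, hrisk⟩ := risk_le_of_piecewiseLogAffine P hn hp.1 hX hindep hM.1.1 hMsub hphat
  refine ⟨hint, ?_⟩
  have hn0 : (0 : ℝ) < n := by exact_mod_cast hn
  have h1 : 0 ≤ 300 / (n : ℝ) ^ (2 / 5 : ℝ) := by positivity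
  have h2 : 0 ≤ 837 / Real.sqrt n := by positivity
  have h3 : 0 ≤ 2 * ε / n := by positivity
  rcases le_or_gt 100000 n with hbig | hsmall
  · obtain ⟨D, r, hrM, hr, hle⟩ := exists_oracle_bound hM hp hbig
    have := hrisk D r hrM hr
    linarith
  · -- for small samples the loss, at most `2`, is below the second term
    have hle : ∫ ω, l1Norm (p - phat (fun i => X i ω)) ∂P ≤ ∫ _ω, (2 : ℝ) ∂P :=
      integral_mono hint (integrable_const _) fun ω =>
        l1Norm_sub_le_two hp.1 (hMsub (hphat.mem_minimizers _).1).1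
    have h4 : (2 : ℝ) ≤ 837 / Real.sqrt n := by
      rw [le_div_iff₀ (Real.sqrt_pos.2 hn0)]
      have : Real.sqrt n ≤ 400 := by
        refine Real.sqrt_le_iff.2 ⟨by norm_num, ?_⟩
        have : (n : ℝ) < 100000 := by exact_mod_cast hsmall
        linarith
      linarith
    simp only [integral_const, probReal_univ, one_smul] at hle
    linarith
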